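/- There are absolute constants $C,c>0$ such that the following holds. Let $\mathcal K\subset\mathbb R^d$ be a convex body (compact, convex, with nonempty interior) with radius $R=\frac12\max_{x,y\in\mathcal K}\|x-y\|_2$, let $\mathcal W$ be a measurable space, let $L_0,\kappa,\varepsilon>0$, and let $f:\mathcal K\times\mathcal W\to\mathbb R$ be such that $f(x,\cdot)$ is measurable for every $x\in\mathcal K$ and $f(\cdot,w)$ is convex and $L_0$-Lipschitz on $\mathcal K$ in $\|\cdot\|_2$ for every $w\in\mathcal W$. For a probability distribution $D$ on $\mathcal W$ with $f(x,\cdot)\in L^1(D)$ for all $x\in\mathcal K$ put $F(x)=\mathbb E_{w\sim D}[f(x,w)]$. A $\mathrm{STAT}_D(\tau)$ oracle answers a query, that is, a measurable function $\phi:\mathcal W\to[-1,1]$, by an arbitrary value $v$ with $|v-\mathbb E_{w\sim D}[\phi(w)]|\le\tau$. A (deterministic, adaptive) statistical query algorithm learns about $D$ only through such answers. Let $\tau=c\,\sqrt{\varepsilon\kappa}/L_0$, which does not depend on $R$. (1) For every $L_1>0$ there is a statistical query algorithm, depending on $\mathcal K,\mathcal W,f,L_0,L_1,\kappa,\varepsilon$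 but not on $D$, with the following property. For every $D$ as above for which $F$ is $\kappa$-strongly convex on $\mathcal K$ and differentiable on $\mathcal K$ (relative to $\mathcal K$ at boundary points) with $L_1$-Lipschitz gradient, both in $\|\cdot\|_2$, and for all answers of the $\mathrm{STAT}_D(\tau)$ oracle, it asks at most $$C\, d\,\frac{L_1}{\kappa}\,\max\Big\{1,\log\frac{L_1R^2}{\varepsilon}\Big\}$$ queries and outputs a point $x\in\mathcal K$ with $F(x)\le\min_{y\in\mathcal K}F(y)+\varepsilon$. (2) There is a statistical query algorithm, depending on $\mathcal K,\mathcal W,f,L_0,\kappa,\varepsilon$ but not on $D$, with the following property. For every $D$ as above for which $F$ is $\kappa$-strongly convex on $\mathcal K$ in $\|\cdot\|_2$, and for all answers of the $\mathrm{STAT}_D(\tau)$ oracle, it asks at most $$C\, d\,\frac{L_0^2}{\varepsilon\kappa}\,\max\Big\{1,\log\frac{L_0R}{\varepsilon}\Big\}$$ queries and outputs a point $x\in\mathcal K$ with $F(x)\le\min_{y\in\mathcal K}F(y)+\varepsilon$. -/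

import Mathlib

open MeasureTheory

universe u v

/-- A statistical query over the domain `W`: a measurable function `φ : W → [-1, 1]`. -/
structure StatQuery (W : Type u) [MeasurableSpace W] where
  toFun : W → ℝ
  measurable_toFun : Measurable toFun
  mem_Icc : ∀ w, toFun w ∈ Set.Icc (-1 : ℝ) 1

/-- A deterministic adaptive statistical query algorithm over `W` with outputs in `X`: it either
stops with an output, or asks a query and continues depending on the real number returned.
It has no access to the input distribution other than the answers. -/
inductive SQAlgorithm (W : Type u) [MeasurableSpace W] (X : Type v) : Type (max u v) where
  | output (x : X) : SQAlgorithm W X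
  | query (φ : StatQuery W) (next : ℝ → SQAlgorithm W X) : SQAlgorithm W X

/-- `SQRun D τ A n x`: in some interaction of `A` with a `STAT_D(τ)` oracle, which may answer a
query `φ` by any `v` with `|v - E_{w ∼ D}[φ(w)]| ≤ τ`, the algorithm asks exactly `n` queries and
outputs `x`. The oracle need not be consistent: its answers may depend on the whole history. -/
inductive SQRun {W : Type u} [MeasurableSpace W] {X : Type v} (D : Measure W) (τ : ℝ) :
    SQAlgorithm W X → ℕ → X → Prop where
  | output (x : X) : SQRun D τ (SQAlgorithm.output x) 0 x
  | query (φ : StatQuery W) (next : ℝ → SQAlgorithm W X) (v : ℝ) (n : ℕ) (x : X)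
      (hv : |v - ∫ w, φ.toFun w ∂D| ≤ τ) (h : SQRun D τ (next v) n x) :
      SQRun D τ (SQAlgorithm.query φ next) (n + 1) x

/-- Whatever the answers of the `STAT_D(τ)` oracle, `A` asks at most `N` queries and its output
satisfies `good`. (Algorithms are well-founded trees, so for `0 ≤ τ` every algorithm has a run.) -/
def SQAlgorithm.Solves {W : Type u} [MeasurableSpace W] {X : Type v} (A : SQAlgorithm W X)
    (D : Measure W) (τ N : ℝ) (good : X → Prop) : Prop :=
  ∀ (n : ℕ) (x : X), SQRun D τ A n x → (n : ℝ) ≤ N ∧ good x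

/-- The expected objective `F(x) = E_{w ∼ D}[f(x, w)]`. -/
noncomputable def expectedObjective {W : Type u} [MeasurableSpace W] {E : Type v}
    (f : E → W → ℝ) (D : Measure W) (x : E) : ℝ :=
  ∫ w, f x w ∂D

/-- `x` is an `ε`-optimal solution of `min_{y ∈ K} F(y)`. -/
def IsEpsOptimal {E : Type v} (K : Set E) (F : E → ℝ) (ε : ℝ) (x : E) : Prop :=
  x ∈ K ∧ ∀ y ∈ K, F x ≤ F y + ε

/-- A convex body in Euclidean space: compact, convex, with nonempty interior. -/
def IsConvexBody {d : ℕ} (K : Set (EuclideanSpace ℝ (Fin d))) : Prop :=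
  Convex ℝ K ∧ IsCompact K ∧ (interior K).Nonempty

/-- Convex functions on `K` that are `L₀`-Lipschitz in the Euclidean norm. (Such a function has a
subgradient at every point of `K`.) -/
def IsConvexLipschitz {d : ℕ} (K : Set (EuclideanSpace ℝ (Fin d))) (L₀ : ℝ)
    (g : EuclideanSpace ℝ (Fin d) → ℝ) : Prop :=
  ConvexOn ℝ K g ∧ ∀ x ∈ K, ∀ y ∈ K, |g x - g y| ≤ L₀ * ‖x - y‖

/-- `F` is differentiable on `K` (one-sidedly at the boundary) and its gradient is `L₁`-Lipschitz
on `K` in the Euclidean norm. -/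
def HasLipschitzGradient {d : ℕ} (K : Set (EuclideanSpace ℝ (Fin d))) (L₁ : ℝ)
    (F : EuclideanSpace ℝ (Fin d) → ℝ) : Prop :=
  ∃ G : EuclideanSpace ℝ (Fin d) → EuclideanSpace ℝ (Fin d),
    (∀ x ∈ K, HasGradientWithinAt F (G x) K x) ∧
    ∀ x ∈ K, ∀ y ∈ K, ‖G x - G y‖ ≤ L₁ * ‖x - y‖

/-- The Euclidean radius `max_{x, y ∈ K} ‖x - y‖ / 2` of `K`. -/
noncomputable def radius {d : ℕ} (K : Set (EuclideanSpace ℝ (Fin d))) : ℝ :=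
  Metric.diam K / 2

/-! Both algorithms run projected gradient descent and estimate the expected gradient by queries in
each round. Two points decide the bounds.

The tolerance must not degrade with `d`. In an orthonormal basis, coordinate errors `τ` add up to a
vector of norm `√d τ`. Instead, about `d` random sign vectors are taken: for a suitable choice, the
sum of `|⟨b i, x⟩|` is comparable to `‖x‖` for all `x`, by exponential moments, a union bound over a
net and an extension by seminorm properties. This sum is the support function of the zonotope
generated by the `b i`, so by duality the zonotope lies between the unit ball and a constant
multiple of it (`exists_zonotope`). Each subgradient, scaled to norm at most `1`, thus has
coefficients in `[-1, 1]`, which serve as queries, and answers off by `τ` move the expected gradient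
by at most `384 * L₀ * τ` (`exists_gradient_queries`).

The tolerance must not depend on the radius. A gradient error `σ` costs `σ * ‖x - y‖`, and strong
convexity pays for it: this is at most `κ / 8 * ‖x - y‖ ^ 2 + 2 * σ ^ 2 / κ`, so `σ` of order `√(κ *
ε)` suffices (`projected_step_le`). A potential then contracts by `1 - κ / (8 * L)` per round
(`exists_solver`).

The solver needs an upper quadratic model with curvature `L` and error `ε / 8`. A Lipschitz gradient
gives one with `L = 2 * L₁`; a Lipschitz function gives one with `L = 16 * L₀ ^ 2 / ε`, by
completing the square. -/

/-! ### Exponential moments of random signed sums -/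

/-- The sign `±1` encoded by a Boolean. -/
def boolSign (b : Bool) : ℝ := if b then 1 else -1

/-- The signed sum `∑ j, ± x j`. -/
def signSum {d : ℕ} (s : Fin d → Bool) (x : EuclideanSpace ℝ (Fin d)) : ℝ :=
  ∑ j, boolSign (s j) * x j

theorem sum_exp_signSum {d : ℕ} (x : EuclideanSpace ℝ (Fin d)) :
    ∑ s : Fin d → Bool, Real.exp (signSum s x) = ∏ j, (2 * Real.cosh (x j)) := by
  have h : ∀ j, 2 * Real.cosh (x j) = ∑ b : Bool, Real.exp (boolSign b * x j) := by
    intro j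
    rw [Real.cosh_eq]
    simp [boolSign]
    ring
  simp only [h, Finset.prod_univ_sum, signSum, Real.exp_sum, Fintype.piFinset_univ]

theorem sum_cos_signSum {d : ℕ} (x : EuclideanSpace ℝ (Fin d)) :
    ∑ s : Fin d → Bool, Real.cos (signSum s x) = ∏ j, (2 * Real.cos (x j)) := by
  have h : ∀ j, (2 * Complex.cos (x j)) =
      ∑ b : Bool, Complex.exp ((boolSign b * x j : ℝ) * Complex.I) := by
    intro j
    rw [Complex.cos]
    simp [boolSign]
    ring
  have h2 : ∏ j, (2 * Complex.cos (x j)) =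
      ∑ s : Fin d → Bool, Complex.exp ((signSum s x : ℝ) * Complex.I) := by
    simp only [h, Finset.prod_univ_sum, signSum, Fintype.piFinset_univ, Complex.ofReal_sum,
      Finset.sum_mul, Complex.exp_sum]
  have h3 := congrArg Complex.re h2
  simp only [Complex.re_sum, Complex.exp_ofReal_mul_I_re] at h3
  rw [← h3]
  have : ((∏ j, (2 * Real.cos (x j)) : ℝ) : ℂ) = ∏ j, (2 * Complex.cos (x j)) := by
    push_cast; rfl
  rw [← this, Complex.ofReal_re]

/-- Since `exp |t| ≤ exp t + exp (-t)`, independence of the signs leaves a product of hyperbolic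
cosines, each at most `exp (x j ^ 2 / 2)`. -/
theorem sum_exp_abs_signSum_le {d : ℕ} (x : EuclideanSpace ℝ (Fin d)) (hx : ‖x‖ = 1) :
    ∑ s : Fin d → Bool, Real.exp |signSum s x| ≤ 2 ^ d * (2 * Real.exp (1 / 2)) := by
  have hneg : ∀ s, signSum s (-x) = -signSum s x := by
    intro s; simp [signSum]
  have hcosh : ∏ j, (2 * Real.cosh (x j)) ≤ 2 ^ d * Real.exp (1 / 2) := by
    rw [Finset.prod_mul_distrib]
    simp only [Finset.prod_const, Finset.card_univ, Fintype.card_fin]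
    gcongr
    have hs : (1 : ℝ) / 2 = ∑ j, x j ^ 2 / 2 := by
      rw [← Finset.sum_div, ← EuclideanSpace.real_norm_sq_eq, hx]; norm_num
    rw [hs, Real.exp_sum]
    exact Finset.prod_le_prod (fun j _ => (Real.cosh_pos _).le)
      fun j _ => Real.cosh_le_exp_half_sq _
  calc ∑ s : Fin d → Bool, Real.exp |signSum s x|
      ≤ ∑ s : Fin d → Bool, (Real.exp (signSum s x) + Real.exp (signSum s (-x))) := by
        refine Finset.sum_le_sum fun s _ => ?_
        rw [hneg]
        rcases abs_choice (signSum s x) with h | h <;> rw [h] <;>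
          linarith [Real.exp_pos (signSum s x), Real.exp_pos (-signSum s x)]
    _ = 2 * ∏ j, (2 * Real.cosh (x j)) := by
        rw [Finset.sum_add_distrib, sum_exp_signSum, sum_exp_signSum]
        simp [Real.cosh_neg]; ring
    _ ≤ _ := by linarith

/-- Replaces `exp (-|s|)`, whose average over signs does not factor, by a cosine, whose average
does. It follows from `exp (-t) ≤ 1 / (1 + t)`, with the quadratic bound on the cosine for `t ≤ 2`
and the trivial one beyond. -/
theorem exp_neg_abs_le_cos (s : ℝ) : Real.exp (-|s|) ≤ 1 - (1 - Real.cos s) / 4 := by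
  rw [← Real.cos_abs s]
  set t := |s| with ht
  have ht0 : 0 ≤ t := abs_nonneg s
  have h1 : Real.exp (-t) ≤ 1 / (1 + t) := by
    rw [Real.exp_neg, ← one_div]
    exact one_div_le_one_div_of_le (by linarith) (by linarith [Real.add_one_le_exp t])
  refine h1.trans ?_
  rw [div_le_iff₀ (by linarith)]
  rcases le_total t 2 with h | h
  · have := Real.one_sub_sq_div_two_le_cos (x := t)
    nlinarith [mul_nonneg ht0 ht0, mul_nonneg (mul_nonneg ht0 ht0) (sub_nonneg.2 h)]
  · nlinarith [Real.neg_one_le_cos t]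

/-- On `[-1, 1]` each cosine is at most `exp (-x j ^ 2 / 5)`, so their product is at most `exp (-1 /
5) ≤ 5 / 6` and the mean is at most `3 / 4 + 5 / 24 = 23 / 24`. -/
theorem sum_exp_neg_abs_signSum_le {d : ℕ} (x : EuclideanSpace ℝ (Fin d)) (hx : ‖x‖ = 1) :
    ∑ s : Fin d → Bool, Real.exp (-|signSum s x|) ≤ 2 ^ d * Real.exp (-(1 / 24)) := by
  have hsum : ∑ j, x j ^ 2 = 1 := by rw [← EuclideanSpace.real_norm_sq_eq, hx]; norm_num
  have hle : ∀ j, |x j| ≤ 1 := by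
    intro j
    rw [← sq_le_one_iff_abs_le_one, ← hsum]
    exact Finset.single_le_sum (f := fun j => x j ^ 2) (fun _ _ => sq_nonneg _)
      (Finset.mem_univ j)
  have hcos : ∏ j, (2 * Real.cos (x j)) ≤ 2 ^ d * (5 / 6) := by
    rw [Finset.prod_mul_distrib]
    simp only [Finset.prod_const, Finset.card_univ, Fintype.card_fin]
    gcongr
    have h1 : ∏ j, Real.cos (x j) ≤ ∏ j, Real.exp (-(x j ^ 2 / 5)) := by
      refine Finset.prod_le_prod (fun j _ => (Real.cos_pos_of_le_one (hle j)).le) fun j _ => ?_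
      have hpi : |x j| ≤ Real.pi := (hle j).trans (by linarith [Real.pi_gt_three])
      refine (Real.cos_le_one_sub_mul_cos_sq hpi).trans ?_
      have hp : (1 : ℝ) / 5 ≤ 2 / Real.pi ^ 2 := by
        rw [div_le_div_iff₀ (by norm_num) (by positivity)]
        nlinarith [Real.pi_lt_d2, Real.pi_pos]
      have := Real.add_one_le_exp (-(x j ^ 2 / 5))
      nlinarith [sq_nonneg (x j)]
    rw [← Real.exp_sum, Finset.sum_neg_distrib, ← Finset.sum_div, hsum] at h1
    refine h1.trans ?_
    rw [Real.exp_neg, inv_le_comm₀ (Real.exp_pos _) (by norm_num)]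
    linarith [Real.add_one_le_exp (1 / 5 : ℝ)]
  calc ∑ s : Fin d → Bool, Real.exp (-|signSum s x|)
      ≤ ∑ s : Fin d → Bool, (3 / 4 + Real.cos (signSum s x) / 4) :=
        Finset.sum_le_sum fun s _ => by linarith [exp_neg_abs_le_cos (signSum s x)]
    _ = 2 ^ d * (3 / 4) + (∏ j, (2 * Real.cos (x j))) / 4 := by
        rw [Finset.sum_add_distrib, ← Finset.sum_div (f := fun s => Real.cos (signSum s x)),
          sum_cos_signSum]
        simp
    _ ≤ 2 ^ d * (23 / 24) := by linarith
    _ ≤ _ := by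
        gcongr
        linarith [Real.add_one_le_exp (-(1 / 24) : ℝ)]

/-! ### Tail bounds, a net of the sphere and the union bound -/

theorem card_filter_lt_mul_exp_le {Ω : Type*} [Fintype Ω] (g : Ω → ℝ) (c : ℝ) :
    ((Finset.univ.filter fun M => c < g M).card : ℝ) * Real.exp c ≤ ∑ M, Real.exp (g M) := by
  rw [← nsmul_eq_mul, ← Finset.sum_const]
  refine (Finset.sum_le_sum fun M hM => Real.exp_le_exp.2 (Finset.mem_filter.1 hM).2.le).trans ?_
  exact Finset.sum_le_sum_of_subset_of_nonneg (Finset.subset_univ _)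
    fun _ _ _ => (Real.exp_pos _).le

/-- Fraction of sign matrices whose averaged signed sums at `x` are large. -/
theorem card_large_signSum_le {d : ℕ} (N : ℕ) (x : EuclideanSpace ℝ (Fin d)) (hx : ‖x‖ = 1) :
    ((Finset.univ.filter fun M : Fin N → Fin d → Bool => 3 * (N : ℝ) < ∑ i, |signSum (M i) x|).card
      : ℝ) ≤ (2 ^ d) ^ N * Real.exp (-(N / 48)) := by
  have h1 := card_filter_lt_mul_exp_le
    (fun M : Fin N → Fin d → Bool => ∑ i, |signSum (M i) x|) (3 * (N : ℝ))
  have h0 : ∑ M : Fin N → Fin d → Bool, Real.exp (∑ i, |signSum (M i) x|) ≤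
      (2 ^ d * (2 * Real.exp (1 / 2))) ^ N := by
    simp only [Real.exp_sum]
    rw [← Fintype.sum_pow fun s => Real.exp |signSum s x|]
    exact pow_le_pow_left₀ (Finset.sum_nonneg fun _ _ => (Real.exp_pos _).le)
          (sum_exp_abs_signSum_le x hx) N
  have h2 : (2 * Real.exp (1 / 2)) ^ N ≤ Real.exp (3 * N) * Real.exp (-(N / 48)) := by
    have : 2 * Real.exp (1 / 2) ≤ Real.exp (3 / 2) := by
      have h3 : (3 / 2 : ℝ) = 1 + 1 / 2 := by norm_num
      rw [h3, Real.exp_add]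
      have := Real.add_one_le_exp (1 : ℝ)
      gcongr
      linarith
    refine (pow_le_pow_left₀ (by positivity) this N).trans ?_
    rw [← Real.exp_nat_mul, ← Real.exp_add]
    apply Real.exp_le_exp.2
    have : (0 : ℝ) ≤ N := Nat.cast_nonneg N
    linarith
  rw [mul_pow] at h0
  have h3 := (h1.trans h0).trans
    (mul_le_mul_of_nonneg_left h2 (by positivity : (0 : ℝ) ≤ (2 ^ d) ^ N))
  rw [mul_comm (Real.exp (3 * N)), ← mul_assoc] at h3
  exact le_of_mul_le_mul_right h3 (Real.exp_pos _)

/-- Fraction of sign matrices whose averaged signed sums at `x` are small. -/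
theorem card_small_signSum_le {d : ℕ} (N : ℕ) (x : EuclideanSpace ℝ (Fin d)) (hx : ‖x‖ = 1) :
    ((Finset.univ.filter fun M : Fin N → Fin d → Bool =>
      -((N : ℝ) / 48) < ∑ i, -|signSum (M i) x|).card : ℝ) ≤
        (2 ^ d) ^ N * Real.exp (-(N / 48)) := by
  have h1 := card_filter_lt_mul_exp_le
    (fun M : Fin N → Fin d → Bool => ∑ i, -|signSum (M i) x|) (-((N : ℝ) / 48))
  have h0 : ∑ M : Fin N → Fin d → Bool, Real.exp (∑ i, -|signSum (M i) x|) ≤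
      (2 ^ d * Real.exp (-(1 / 24))) ^ N := by
    simp only [Real.exp_sum]
    rw [← Fintype.sum_pow fun s => Real.exp (-|signSum s x|)]
    exact pow_le_pow_left₀ (Finset.sum_nonneg fun _ _ => (Real.exp_pos _).le)
          (sum_exp_neg_abs_signSum_le x hx) N
  have h2 : Real.exp (-(1 / 24)) ^ N = Real.exp (-(N / 48)) * Real.exp (-(N / 48)) := by
    rw [← Real.exp_nat_mul, ← Real.exp_add]
    congr 1; ring
  rw [mul_pow, h2, ← mul_assoc] at h0
  exact le_of_mul_le_mul_right (h1.trans h0) (Real.exp_pos _)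

open Metric Module Function ENNReal in
/-- A `1/400`-separated set in the unit ball has at most `801 ^ d` elements. -/
theorem card_le_of_separated_unitBall {d : ℕ} (s : Finset (EuclideanSpace ℝ (Fin d)))
    (hs : ∀ c ∈ s, ‖c‖ ≤ 1) (h : ∀ c ∈ s, ∀ e ∈ s, c ≠ e → 1 / 400 ≤ ‖c - e‖) :
    s.card ≤ 801 ^ d := by
  let μ : Measure (EuclideanSpace ℝ (Fin d)) := volume
  let δ : ℝ := (1 : ℝ) / 800
  let ρ : ℝ := (801 : ℝ) / 800
  have ρpos : 0 < ρ := by norm_num [ρ]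
  have δpos : 0 < δ := by norm_num [δ]
  set A := ⋃ c ∈ s, ball c δ with hA
  have D : Set.Pairwise (s : Set (EuclideanSpace ℝ (Fin d)))
      (Disjoint on fun c => ball c δ) := by
    rintro c hc e he hce
    apply ball_disjoint_ball
    rw [dist_eq_norm]
    have := h c hc e he hce
    norm_num [δ]
    linarith
  have A_subset : A ⊆ ball 0 ρ := by
    refine Set.iUnion₂_subset fun x hx => ?_
    apply ball_subset_ball'
    rw [dist_zero_right]
    have := hs x hx
    norm_num [δ, ρ]
    linarith
  have I : (s.card : ℝ≥0∞) * ENNReal.ofReal (δ ^ d) * μ (ball 0 1) ≤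
      ENNReal.ofReal (ρ ^ d) * μ (ball 0 1) :=
    calc
      (s.card : ℝ≥0∞) * ENNReal.ofReal (δ ^ d) * μ (ball 0 1) = μ A := by
        rw [hA, measure_biUnion_finset D fun c _ => measurableSet_ball]
        simp only [μ.addHaar_ball_of_pos _ δpos, finrank_euclideanSpace_fin]
        simp only [Finset.sum_const, nsmul_eq_mul, mul_assoc]
      _ ≤ μ (ball 0 ρ) := measure_mono A_subset
      _ = ENNReal.ofReal (ρ ^ d) * μ (ball 0 1) := by
        simp only [μ.addHaar_ball_of_pos _ ρpos, finrank_euclideanSpace_fin]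
  have J : (s.card : ℝ≥0∞) * ENNReal.ofReal (δ ^ d) ≤ ENNReal.ofReal (ρ ^ d) :=
    (ENNReal.mul_le_mul_iff_left (measure_ball_pos _ _ zero_lt_one).ne' measure_ball_lt_top.ne).1 I
  have K : (s.card : ℝ) * δ ^ d ≤ ρ ^ d := by
    have := ENNReal.toReal_le_of_le_ofReal (pow_nonneg ρpos.le _) J
    simpa [ENNReal.toReal_mul, ENNReal.toReal_ofReal (pow_nonneg δpos.le d)] using this
  have e : ρ = 801 * δ := by norm_num [ρ, δ]
  rw [e, mul_pow] at K
  exact_mod_cast le_of_mul_le_mul_right K (pow_pos δpos d)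

/-- If no set of this size were a net, separated sets could be enlarged one point at a time past the
volumetric bound. -/
theorem exists_net_unitSphere (d : ℕ) :
    ∃ s : Finset (EuclideanSpace ℝ (Fin d)), (∀ c ∈ s, ‖c‖ = 1) ∧ s.card ≤ 801 ^ d ∧
      ∀ x : EuclideanSpace ℝ (Fin d), ‖x‖ = 1 → ∃ c ∈ s, ‖x - c‖ ≤ 1 / 400 := by
  classical
  by_contra! H
  have key : ∀ n : ℕ, ∃ s : Finset (EuclideanSpace ℝ (Fin d)), (∀ c ∈ s, ‖c‖ = 1) ∧
      (∀ c ∈ s, ∀ e ∈ s, c ≠ e → 1 / 400 ≤ ‖c - e‖) ∧ s.card = n := by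
    intro n
    induction n with
    | zero => exact ⟨∅, by simp⟩
    | succ n ih =>
      obtain ⟨s, h1, h2, h3⟩ := ih
      obtain ⟨x, hx, hxs⟩ := H s h1
        (card_le_of_separated_unitBall s (fun c hc => (h1 c hc).le) h2)
      have hxn : x ∉ s := fun hmem => by
        have := hxs x hmem
        simp at this
        linarith
      refine ⟨insert x s, ?_, ?_, by rw [Finset.card_insert_of_notMem hxn, h3]⟩
      · intro c hc
        rcases Finset.mem_insert.1 hc with rfl | hc
        exacts [hx, h1 c hc]
      · intro c hc e he hce
        rcases Finset.mem_insert.1 hc with rfl | hc <;> rcases Finset.mem_insert.1 he with rfl | he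
        · exact absurd rfl hce
        · exact (hxs e he).le
        · rw [norm_sub_rev]; exact (hxs c ‹_›).le
        · exact h2 c hc e he hce
  obtain ⟨s, h1, h2, h3⟩ := key (801 ^ d + 1)
  have := card_le_of_separated_unitBall s (fun c hc => (h1 c hc).le) h2
  omega

theorem signSum_add {d : ℕ} (s : Fin d → Bool) (x y : EuclideanSpace ℝ (Fin d)) :
    signSum s (x + y) = signSum s x + signSum s y := by
  simp [signSum, mul_add, Finset.sum_add_distrib]

theorem signSum_smul {d : ℕ} (s : Fin d → Bool) (c : ℝ) (x : EuclideanSpace ℝ (Fin d)) :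
    signSum s (c • x) = c * signSum s x := by
  simp only [signSum, Finset.mul_sum, PiLp.smul_apply, smul_eq_mul]
  exact Finset.sum_congr rfl fun j _ => by ring

theorem continuous_signSum {d : ℕ} (s : Fin d → Bool) : Continuous (signSum s) := by
  unfold signSum
  fun_prop

theorem two_mul_pow_mul_exp_lt_one {d : ℕ} (hd : 0 < d) :
    (801 : ℝ) ^ d * (2 * Real.exp (-(8 * d))) < 1 := by
  have h1 : (801 : ℝ) ≤ Real.exp 7 := by
    have h : (Real.exp 1) ^ 7 = Real.exp 7 := by rw [← Real.exp_nat_mul]; norm_num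
    rw [← h]
    have := pow_le_pow_left₀ (by norm_num) Real.exp_one_gt_d9.le 7
    exact le_trans (by norm_num) this
  have h2 : (801 : ℝ) ^ d ≤ Real.exp (7 * d) := by
    refine (pow_le_pow_left₀ (by norm_num) h1 d).trans ?_
    rw [← Real.exp_nat_mul, mul_comm]
  have h3 : Real.exp (7 * d) * Real.exp (-(8 * d)) = Real.exp (-d) := by
    rw [← Real.exp_add]; congr 1; ring
  have h4 : Real.exp (-(d : ℝ)) < 1 / 2 := by
    have h5 : (1 : ℝ) ≤ d := by exact_mod_cast hd
    refine (Real.exp_le_exp.2 (neg_le_neg h5)).trans_lt ?_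
    rw [Real.exp_neg, inv_lt_comm₀ (Real.exp_pos _) (by norm_num)]
    have := Real.exp_one_gt_d9
    norm_num
    linarith
  have h6 := mul_le_mul_of_nonneg_right h2 (Real.exp_pos (-(8 * d : ℝ))).le
  nlinarith

theorem exists_signs_on_finset {d : ℕ} (hd : 0 < d) (s : Finset (EuclideanSpace ℝ (Fin d)))
    (hs : ∀ c ∈ s, ‖c‖ = 1) (hcard : s.card ≤ 801 ^ d) :
    ∃ M : Fin (384 * d) → Fin d → Bool, ∀ c ∈ s,
      8 * (d : ℝ) ≤ ∑ i, |signSum (M i) c| ∧ ∑ i, |signSum (M i) c| ≤ 1152 * d := by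
  classical
  by_contra! H
  -- With this `N`, `N / 48 = 8 * d`: each tail has probability at most `exp (-8 * d)`, which beats
  -- the net, of size at most `801 ^ d ≤ exp (7 * d)`.
  set N := 384 * d with hN
  have hNr : (N : ℝ) = 384 * d := by rw [hN]; push_cast; ring
  let bad : EuclideanSpace ℝ (Fin d) → Finset (Fin N → Fin d → Bool) := fun x =>
    (Finset.univ.filter fun M : Fin N → Fin d → Bool => 3 * (N : ℝ) < ∑ i, |signSum (M i) x|) ∪
    (Finset.univ.filter fun M : Fin N → Fin d → Bool =>
      -((N : ℝ) / 48) < ∑ i, -|signSum (M i) x|)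
  have hcover : (Finset.univ : Finset (Fin N → Fin d → Bool)) ⊆ s.biUnion bad := by
    intro M _
    obtain ⟨c, hc, h⟩ := H M
    refine Finset.mem_biUnion.2 ⟨c, hc, Finset.mem_union.2 ?_⟩
    rcases lt_or_ge (∑ i, |signSum (M i) c|) (8 * (d : ℝ)) with h1 | h1
    · right
      refine Finset.mem_filter.2 ⟨Finset.mem_univ _, ?_⟩
      rw [Finset.sum_neg_distrib, hNr]
      linarith
    · left
      refine Finset.mem_filter.2 ⟨Finset.mem_univ _, ?_⟩
      rw [hNr]
      linarith [h h1]
  have hbad : ∀ c ∈ s, ((bad c).card : ℝ) ≤ (2 ^ d) ^ N * (2 * Real.exp (-(8 * d))) := by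
    intro c hc
    have h1 := card_large_signSum_le N c (hs c hc)
    have h2 := card_small_signSum_le N c (hs c hc)
    have h0 : (bad c).card ≤ _ := Finset.card_union_le _ _
    have h3 := (Nat.cast_le (α := ℝ)).2 h0
    have h4 : (N : ℝ) / 48 = 8 * d := by rw [hNr]; ring
    rw [h4] at h1
    rw [show Real.exp (-((N : ℝ) / 48)) = Real.exp (-(8 * d)) by rw [h4]] at h2
    push_cast at h3
    linarith
  have h1 : ((2 : ℝ) ^ d) ^ N ≤ (s.card : ℝ) * ((2 ^ d) ^ N * (2 * Real.exp (-(8 * d)))) := by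
    calc ((2 : ℝ) ^ d) ^ N = ((Finset.univ : Finset (Fin N → Fin d → Bool)).card : ℝ) := by simp
      _ ≤ ((s.biUnion bad).card : ℝ) := by exact_mod_cast Finset.card_le_card hcover
      _ ≤ ∑ c ∈ s, ((bad c).card : ℝ) := by exact_mod_cast Finset.card_biUnion_le
      _ ≤ ∑ c ∈ s, ((2 : ℝ) ^ d) ^ N * (2 * Real.exp (-(8 * d))) := Finset.sum_le_sum hbad
      _ = _ := by simp
  have h2 : (s.card : ℝ) ≤ 801 ^ d := by exact_mod_cast hcard
  have h3 := two_mul_pow_mul_exp_lt_one hd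
  have hA : (0 : ℝ) < (2 ^ d) ^ N := by positivity
  have h4 : (s.card : ℝ) * (2 * Real.exp (-(8 * d))) < 1 :=
    (mul_le_mul_of_nonneg_right h2 (by positivity)).trans_lt h3
  nlinarith

/-- The averaged sum is a seminorm, so its bounds on a fine net extend to the sphere. -/
theorem exists_signs {d : ℕ} (hd : 0 < d) :
    ∃ M : Fin (384 * d) → Fin d → Bool, ∀ x,
      4 * (d : ℝ) * ‖x‖ ≤ ∑ i, |signSum (M i) x| ∧
        ∑ i, |signSum (M i) x| ≤ 1536 * d * ‖x‖ := by
  obtain ⟨s, hs1, hs2, hs3⟩ := exists_net_unitSphere d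
  obtain ⟨M, hM⟩ := exists_signs_on_finset hd s hs1 hs2
  set p : EuclideanSpace ℝ (Fin d) → ℝ := fun x => ∑ i, |signSum (M i) x| with hp
  have hadd : ∀ x y, p (x + y) ≤ p x + p y := by
    intro x y
    simp only [hp, ← Finset.sum_add_distrib, signSum_add]
    exact Finset.sum_le_sum fun i _ => abs_add_le _ _
  have hsmul : ∀ (c : ℝ) x, p (c • x) = |c| * p x := by
    intro c x
    simp only [hp, signSum_smul, abs_mul, Finset.mul_sum]
  have hcont : Continuous p :=
    continuous_finsetSum _ fun i _ => (continuous_signSum _).abs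
  have hunit : ∀ B : ℝ, (∀ x, ‖x‖ = 1 → p x ≤ B) → ∀ x, p x ≤ B * ‖x‖ := by
    intro B hB x
    rcases eq_or_ne x 0 with rfl | hx
    · simpa using (hsmul 0 0).le
    · have hn : 0 < ‖x‖ := norm_pos_iff.2 hx
      have h := hB (‖x‖⁻¹ • x) (by rw [norm_smul]; simp [hn.ne'])
      rw [hsmul, abs_of_pos (inv_pos.2 hn), inv_mul_le_iff₀ hn] at h
      linarith
  have hd0 : (0 : ℝ) < d := by exact_mod_cast hd
  have : Nontrivial (EuclideanSpace ℝ (Fin d)) := by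
    have : Nonempty (Fin d) := ⟨⟨0, hd⟩⟩
    infer_instance
  obtain ⟨x0, hx0, hmax⟩ := (isCompact_sphere (0 : EuclideanSpace ℝ (Fin d)) 1).exists_isMaxOn
    (NormedSpace.sphere_nonempty.2 zero_le_one) hcont.continuousOn
  have hx0' : ‖x0‖ = 1 := by simpa using hx0
  have hle0 : ∀ x, p x ≤ p x0 * ‖x‖ :=
    hunit _ fun x hx => hmax (by simpa using hx)
  -- Bootstrapping at the maximum: `p x0 ≤ 1152 * d + p x0 / 400`. On the whole sphere the lower
  -- bound then drops from `8 * d` by at most `1155 * d / 400`.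
  have hup : p x0 ≤ 1155 * d := by
    obtain ⟨c, hc, hxc⟩ := hs3 x0 hx0'
    have h1 := hadd c (x0 - c)
    rw [add_sub_cancel] at h1
    have h2 := hle0 (x0 - c)
    have h3 := (hM c hc).2
    have h4 : 0 ≤ p x0 := Finset.sum_nonneg fun _ _ => abs_nonneg _
    have h5 : p x0 * ‖x0 - c‖ ≤ p x0 * (1 / 400) := mul_le_mul_of_nonneg_left hxc h4
    have h6 : p c ≤ 1152 * d := h3
    linarith
  have hlow : ∀ x, ‖x‖ = 1 → 4 * d ≤ p x := by
    intro x hx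
    obtain ⟨c, hc, hxc⟩ := hs3 x hx
    have h1 := hadd x (c - x)
    rw [add_sub_cancel] at h1
    have h2 := hle0 (c - x)
    rw [norm_sub_rev] at h2
    have h3 : 8 * d ≤ p c := (hM c hc).1
    have h4 : 0 ≤ p x0 := Finset.sum_nonneg fun _ _ => abs_nonneg _
    have h5 : p x0 * ‖x - c‖ ≤ p x0 * (1 / 400) := mul_le_mul_of_nonneg_left hxc h4
    linarith
  refine ⟨M, fun x => ⟨?_, ?_⟩⟩
  · change 4 * d * ‖x‖ ≤ p x
    rcases eq_or_ne x 0 with rfl | hx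
    · simpa using (hsmul 0 0).ge
    · have hn : 0 < ‖x‖ := norm_pos_iff.2 hx
      have h := hlow (‖x‖⁻¹ • x) (by rw [norm_smul]; simp [hn.ne'])
      rw [hsmul, abs_of_pos (inv_pos.2 hn), le_inv_mul_iff₀ hn] at h
      linarith
  · refine (hle0 x).trans (mul_le_mul_of_nonneg_right ?_ (norm_nonneg x))
    linarith

/-! ### The zonotope -/

/-- A zonotope with `384 * d` generators that is equivalent to the Euclidean ball up to an absolute
constant: every vector of the unit ball has coefficients of absolute value at most `1`, and
coefficients of absolute value at most `1` give vectors of norm at most `384`. -/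
theorem exists_zonotope (d : ℕ) :
    ∃ b : Fin (384 * d) → EuclideanSpace ℝ (Fin d),
      (∀ e : Fin (384 * d) → ℝ, (∀ i, |e i| ≤ 1) → ‖∑ i, e i • b i‖ ≤ 384) ∧
      ∀ g : EuclideanSpace ℝ (Fin d), ‖g‖ ≤ 1 →
        ∃ a : Fin (384 * d) → ℝ, (∀ i, |a i| ≤ 1) ∧ ∑ i, a i • b i = g := by
  rcases Nat.eq_zero_or_pos d with rfl | hd
  · exact ⟨fun _ => 0, fun e _ => by simp, fun g _ => ⟨0, by simp, Subsingleton.elim _ _⟩⟩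
  obtain ⟨M, hM⟩ := exists_signs hd
  have hd0 : (0 : ℝ) < d := by exact_mod_cast hd
  let b : Fin (384 * d) → EuclideanSpace ℝ (Fin d) := fun i =>
    (4 * (d : ℝ))⁻¹ • WithLp.toLp 2 fun j => boolSign (M i j)
  have hb : ∀ i x, inner ℝ (b i) x = (4 * (d : ℝ))⁻¹ * signSum (M i) x := by
    intro i x
    simp only [b, inner_smul_left, signSum, PiLp.inner_apply]
    simp [mul_comm]
  have hlow : ∀ x, ‖x‖ ≤ ∑ i, |inner ℝ (b i) x| := by
    intro x
    simp only [hb, abs_mul, ← Finset.mul_sum]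
    rw [abs_of_pos (by positivity), le_inv_mul_iff₀ (by positivity)]
    exact (hM x).1
  have hup : ∀ x, ∑ i, |inner ℝ (b i) x| ≤ 384 * ‖x‖ := by
    intro x
    simp only [hb, abs_mul, ← Finset.mul_sum]
    rw [abs_of_pos (by positivity), inv_mul_le_iff₀ (by positivity)]
    linarith [(hM x).2]
  refine ⟨b, fun e he => ?_, fun g hg => ?_⟩
  · set s := ∑ i, e i • b i with hs
    have h1 : ‖s‖ * ‖s‖ ≤ 384 * ‖s‖ := by
      calc ‖s‖ * ‖s‖ = inner ℝ s s := (real_inner_self_eq_norm_mul_norm s).symm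
        _ = ∑ i, e i * inner ℝ (b i) s := by
            conv_lhs => rw [hs, sum_inner]
            simp only [inner_smul_left, hs]; rfl
        _ ≤ ∑ i, |inner ℝ (b i) s| := by
            refine Finset.sum_le_sum fun i _ => (le_abs_self _).trans ?_
            rw [abs_mul]
            exact mul_le_of_le_one_left (abs_nonneg _) (he i)
        _ ≤ _ := hup s
    rcases (norm_nonneg s).eq_or_lt with h | h
    · rw [← h]; norm_num
    · exact le_of_mul_le_mul_right h1 h
  · by_contra hne
    push Not at hne
    let φ : (Fin (384 * d) → ℝ) →ₗ[ℝ] EuclideanSpace ℝ (Fin d) := Fintype.linearCombination ℝ b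
    let Q : Set (Fin (384 * d) → ℝ) := Set.Icc (fun _ => -1) (fun _ => 1)
    have hQmem : ∀ a, (∀ i, |a i| ≤ 1) ↔ a ∈ Q := fun a =>
      ⟨fun h => ⟨fun i => (abs_le.1 (h i)).1, fun i => (abs_le.1 (h i)).2⟩,
        fun h i => abs_le.2 ⟨h.1 i, h.2 i⟩⟩
    have hφ : ∀ a, φ a = ∑ i, a i • b i := fun a => Fintype.linearCombination_apply ℝ b a
    have hcomp : IsCompact (φ '' Q) :=
      isCompact_Icc.image φ.continuous_of_finiteDimensional
    have hconv : Convex ℝ (φ '' Q) := (convex_Icc _ _).linear_image φ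
    have hg' : g ∉ φ '' Q := by
      rintro ⟨a, ha, h⟩
      exact hne a ((hQmem a).2 ha) ((hφ a).symm.trans h)
    -- A functional separating `g` from the zonotope is tested at the sign pattern that maximizes
    -- it; the maximum is the sum in `hlow`.
    obtain ⟨l, r, hl, hr⟩ := geometric_hahn_banach_closed_point hconv hcomp.isClosed hg'
    set x := (InnerProductSpace.toDual ℝ (EuclideanSpace ℝ (Fin d))).symm l with hx
    have hlx : ∀ y, l y = inner ℝ x y := fun y => by
      rw [hx, InnerProductSpace.toDual_symm_apply]
    have h1 := hl (φ fun i => SignType.sign (inner ℝ (b i) x))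
      ⟨_, (hQmem _).1 fun i => by
        rcases SignType.sign (inner ℝ (b i) x) with _ | _ | _ <;> simp, rfl⟩
    rw [hφ, hlx, inner_sum] at h1
    simp only [inner_smul_right, real_inner_comm (b _) x] at h1
    have h2 : ∑ i, |inner ℝ (b i) x| < r := by
      refine lt_of_eq_of_lt (Finset.sum_congr rfl fun i _ => ?_) h1
      rw [real_inner_comm]
      exact (sign_mul_self _).symm
    have h3 : l g ≤ ‖x‖ := by
      rw [hlx]
      refine (real_inner_le_norm _ _).trans ?_
      exact mul_le_of_le_one_right (norm_nonneg _) hg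
    linarith [hlow x]

/-! ### Subgradients and their estimation by queries -/

/-- The epigraph is disjoint from the open downward cone of slope `L₀` with apex `(x, h x)`, because
`h` is Lipschitz. A separating hyperplane passes through the apex; its slope is a subgradient,
bounded by `L₀` because the cone lies below it. This works also at boundary points of `K`. -/
theorem exists_subgradient {d : ℕ} {K : Set (EuclideanSpace ℝ (Fin d))} {L₀ : ℝ}
    {h : EuclideanSpace ℝ (Fin d) → ℝ} (hL₀ : 0 ≤ L₀) (hh : IsConvexLipschitz K L₀ h)
    {x : EuclideanSpace ℝ (Fin d)} (hx : x ∈ K) :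
    ∃ g : EuclideanSpace ℝ (Fin d), ‖g‖ ≤ L₀ ∧ ∀ y ∈ K, h x + inner ℝ g (y - x) ≤ h y := by
  let s : Set (EuclideanSpace ℝ (Fin d) × ℝ) := {p | p.2 < h x - L₀ * ‖p.1 - x‖}
  have hsc : Convex ℝ s := by
    rintro ⟨y, t⟩ hy ⟨z, r⟩ hz a b ha hb hab
    change t < _ at hy
    change r < _ at hz
    change a • t + b • r < h x - L₀ * ‖a • y + b • z - x‖
    have h1 : ‖a • y + b • z - x‖ ≤ a * ‖y - x‖ + b * ‖z - x‖ := by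
      have : a • y + b • z - x = a • (y - x) + b • (z - x) := by
        rw [smul_sub, smul_sub, sub_add_sub_comm, ← add_smul, hab, one_smul]
      rw [this]
      refine (norm_add_le _ _).trans ?_
      rw [norm_smul, norm_smul, Real.norm_of_nonneg ha, Real.norm_of_nonneg hb]
    have h2 := mul_le_mul_of_nonneg_left h1 hL₀
    simp only [smul_eq_mul]
    obtain rfl : a = 1 - b := by linarith
    rcases hb.eq_or_lt with rfl | hb
    · simp at h2 ⊢; simp at hy; linarith
    · nlinarith [mul_le_mul_of_nonneg_left hy.le ha, mul_lt_mul_of_pos_left hz hb]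
  have hso : IsOpen s := isOpen_lt continuous_snd (by fun_prop)
  have hT := hh.1.convex_epigraph
  have hdisj : Disjoint s {p | p.1 ∈ K ∧ h p.1 ≤ p.2} := by
    rw [Set.disjoint_left]
    rintro ⟨y, t⟩ hy ⟨hyK, hyt⟩
    change t < h x - L₀ * ‖y - x‖ at hy
    have := (abs_le.1 (hh.2 y hyK x hx)).1
    simp only at hyt
    linarith
  obtain ⟨l, u, hl, hu⟩ := geometric_hahn_banach_open hsc hso hT hdisj
  set β := l (0, 1) with hβ
  have hsplit : ∀ y t, l (y, t) = l (y, 0) + t * β := by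
    intro y t
    have : ((y, t) : EuclideanSpace ℝ (Fin d) × ℝ) = (y, 0) + t • (0, 1) := by simp
    rw [this, map_add, map_smul, smul_eq_mul]
  have hβ0 : 0 < β := by
    have h1 := hl (x, h x - 1) (by simp [s])
    have h2 := hu (x, h x) ⟨hx, le_rfl⟩
    rw [hsplit] at h1 h2
    linarith
  have hlim : ∀ y, l (y, 0) + (h x - L₀ * ‖y - x‖) * β ≤ u := by
    intro y
    refine le_of_forall_pos_le_add fun r hr => ?_
    have h1 := hl (y, h x - L₀ * ‖y - x‖ - r / β) (by
      change _ - r / β < _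
      linarith [div_pos hr hβ0])
    rw [hsplit, sub_mul, div_mul_cancel₀ _ hβ0.ne'] at h1
    linarith
  let l₁ : StrongDual ℝ (EuclideanSpace ℝ (Fin d)) :=
    l.comp (ContinuousLinearMap.inl ℝ (EuclideanSpace ℝ (Fin d)) ℝ)
  let v := (InnerProductSpace.toDual ℝ (EuclideanSpace ℝ (Fin d))).symm l₁
  have hv : ∀ y, inner ℝ v y = l (y, 0) := fun y => by
    simp only [v, InnerProductSpace.toDual_symm_apply]
    rfl
  have hux := hlim x
  simp only [sub_self, norm_zero, mul_zero, sub_zero] at hux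
  have hub : u ≤ l (x, 0) + h x * β := by
    have := hu (x, h x) ⟨hx, le_rfl⟩
    rwa [hsplit] at this
  refine ⟨-(β⁻¹ • v), ?_, fun y hy => ?_⟩
  · have h1 := hlim (x + v)
    rw [← hv, inner_add_right, hv x, real_inner_self_eq_norm_mul_norm, add_sub_cancel_left] at h1
    have h2 : ‖v‖ * ‖v‖ ≤ (L₀ * β) * ‖v‖ := by nlinarith
    have h3 : ‖v‖ ≤ L₀ * β := by
      rcases (norm_nonneg v).eq_or_lt with h | h
      · rw [← h]; positivity
      · exact le_of_mul_le_mul_right h2 h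
    rw [norm_neg, norm_smul, Real.norm_of_nonneg (inv_pos.2 hβ0).le, inv_mul_le_iff₀ hβ0]
    linarith
  · have h1 := hu (y, h y) ⟨hy, le_rfl⟩
    rw [hsplit] at h1
    rw [inner_neg_left, inner_smul_left, inner_sub_right, hv, hv]
    simp only [conj_trivial]
    have h2 : β⁻¹ * (l (x, 0) - l (y, 0)) ≤ h y - h x := by
      rw [inv_mul_le_iff₀ hβ0]
      linarith
    linarith

/-- A countably valued measurable selection of approximate subgradients. -/
theorem exists_measurable_subgradient {d : ℕ} {K : Set (EuclideanSpace ℝ (Fin d))}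
    (hK : IsCompact K) {W : Type u} [MeasurableSpace W] {f : EuclideanSpace ℝ (Fin d) → W → ℝ}
    {L₀ : ℝ} (hL₀ : 0 ≤ L₀) (hmeas : ∀ x ∈ K, Measurable (f x))
    (hf : ∀ w, IsConvexLipschitz K L₀ fun x => f x w) {x : EuclideanSpace ℝ (Fin d)} (hx : x ∈ K)
    {δ : ℝ} (hδ : 0 < δ) :
    ∃ (g : ℕ → EuclideanSpace ℝ (Fin d)) (n : W → ℕ), Measurable n ∧ (∀ k, ‖g k‖ ≤ L₀) ∧
      ∀ w, ∀ y ∈ K, f x w + inner ℝ (g (n w)) (y - x) - δ ≤ f y w := by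
  classical
  obtain ⟨B, hB0, hB⟩ : ∃ B : ℝ, 0 < B ∧ ∀ y ∈ K, ‖y - x‖ ≤ B := by
    refine ⟨Metric.diam K + 1, by linarith [Metric.diam_nonneg (s := K)], fun y hy => ?_⟩
    rw [← dist_eq_norm]
    linarith [Metric.dist_le_diam_of_mem hK.isBounded hy hx]
  let b := Metric.closedBall (0 : EuclideanSpace ℝ (Fin d)) L₀
  have : Nonempty b := ⟨⟨0, Metric.mem_closedBall_self hL₀⟩⟩
  have : Nonempty K := ⟨⟨x, hx⟩⟩
  -- The slack `δ` allows the subgradient to be taken from a dense sequence, so the least admissible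
  -- index is a measurable choice.
  obtain ⟨q, hq⟩ := TopologicalSpace.exists_dense_seq K
  obtain ⟨r, hr⟩ := TopologicalSpace.exists_dense_seq b
  let g : ℕ → EuclideanSpace ℝ (Fin d) := fun k => r k
  have hg : ∀ k, ‖g k‖ ≤ L₀ := fun k => mem_closedBall_zero_iff.1 (r k).2
  let p : W → ℕ → Prop := fun w k => ∀ y ∈ K, f x w + inner ℝ (g k) (y - x) - δ ≤ f y w
  have hcont : ∀ w, Continuous fun y : K => f y w := by
    intro w
    refine (LipschitzWith.of_dist_le_mul (K := L₀.toNNReal) fun y z => ?_).continuous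
    rw [Real.coe_toNNReal _ hL₀, Real.dist_eq, Subtype.dist_eq, dist_eq_norm]
    exact (hf w).2 y y.2 z z.2
  have hp : ∀ w, ∃ k, p w k := by
    intro w
    obtain ⟨v, hv, hvy⟩ := exists_subgradient hL₀ (hf w) hx
    obtain ⟨k, hk⟩ := hr.exists_dist_lt
      (⟨v, by simpa [b] using hv⟩ : b) (div_pos hδ hB0)
    refine ⟨k, fun y hy => ?_⟩
    have h1 : ‖v - g k‖ < δ / B := by rwa [Subtype.dist_eq, dist_eq_norm] at hk
    have h2 : inner ℝ (g k) (y - x) = inner ℝ v (y - x) - inner ℝ (v - g k) (y - x) := by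
      rw [← inner_sub_left, sub_sub_cancel]
    have h3 : |inner ℝ (v - g k) (y - x)| ≤ δ := by
      refine (abs_real_inner_le_norm _ _).trans ?_
      calc ‖v - g k‖ * ‖y - x‖ ≤ (δ / B) * B :=
            mul_le_mul h1.le (hB y hy) (norm_nonneg _) (by positivity)
        _ = δ := div_mul_cancel₀ _ hB0.ne'
    have h4 := hvy y hy
    rw [h2]
    linarith [(abs_le.1 h3).1]
  have hm : ∀ k, MeasurableSet {w | p w k} := by
    intro k
    -- By continuity in `y`, countably many `y` suffice, which makes the set measurable.
    have : {w | p w k} = ⋂ j : ℕ, {w | f x w + inner ℝ (g k)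
        (q j - x) - δ ≤ f (q j) w} := by
      ext w
      rw [Set.mem_iInter]
      constructor
      · exact fun h j => h _ (q j).2
      · intro h y hy
        have hc : Continuous fun y : K =>
            f x w + inner ℝ (g k) ((y : EuclideanSpace ℝ (Fin d)) - x) - δ := by fun_prop
        exact hq.induction_on (p := fun y : K => f x w +
          inner ℝ (g k) ((y : EuclideanSpace ℝ (Fin d)) - x) - δ ≤ f y w) ⟨y, hy⟩
          (isClosed_le hc (hcont w)) h
    rw [this]
    refine MeasurableSet.iInter fun j => ?_
    have hl : Measurable fun w => f x w + inner ℝ (g k) (q j - x) - δ :=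
      ((hmeas x hx).add_const _).sub_const _
    exact measurableSet_le hl (hmeas _ (q j).2)
  exact ⟨g, fun w => Nat.find (hp w), measurable_find hp hm, hg, fun w => Nat.find_spec (hp w)⟩

/-- Estimation of an approximate subgradient of the expected objective by `384 * d` statistical
queries. -/
theorem exists_gradient_queries {d : ℕ} {K : Set (EuclideanSpace ℝ (Fin d))}
    (hK : IsCompact K) {W : Type u} [MeasurableSpace W] {f : EuclideanSpace ℝ (Fin d) → W → ℝ}
    {L₀ : ℝ} (hL₀ : 0 < L₀) (hmeas : ∀ x ∈ K, Measurable (f x))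
    (hf : ∀ w, IsConvexLipschitz K L₀ fun x => f x w) {x : EuclideanSpace ℝ (Fin d)} (hx : x ∈ K)
    {δ : ℝ} (hδ : 0 < δ) :
    ∃ (φ : Fin (384 * d) → StatQuery W) (b : Fin (384 * d) → EuclideanSpace ℝ (Fin d)),
      ∀ (D : Measure W) [IsProbabilityMeasure D], (∀ y ∈ K, Integrable (f y) D) →
        ∃ G : EuclideanSpace ℝ (Fin d), (∀ z, -(L₀ * ‖z‖) ≤ inner ℝ G z) ∧
          (∀ y ∈ K, expectedObjective f D x + inner ℝ G (y - x) - δ ≤ expectedObjective f D y) ∧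
          ∀ τ : ℝ, 0 ≤ τ → ∀ v : Fin (384 * d) → ℝ,
            (∀ i, |v i - ∫ w, (φ i).toFun w ∂D| ≤ τ) →
            ‖∑ i, v i • b i - G‖ ≤ 384 * L₀ * τ := by
  obtain ⟨g, n, hn, hg, hsub⟩ := exists_measurable_subgradient hK hL₀.le hmeas hf hx hδ
  obtain ⟨b, hb1, hb2⟩ := exists_zonotope d
  have hgn : ∀ k, ‖L₀⁻¹ • g k‖ ≤ 1 := fun k => by
    rw [norm_smul, Real.norm_of_nonneg (inv_pos.2 hL₀).le, inv_mul_le_iff₀ hL₀, mul_one]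
    exact hg k
  choose a ha1 ha2 using fun k => hb2 _ (hgn k)
  -- The queries are the zonotope coefficients of the rescaled subgradient, a function of the index
  -- `n w` alone.
  let φ : Fin (384 * d) → StatQuery W := fun i =>
    { toFun := fun w => a (n w) i
      measurable_toFun := (measurable_from_nat (f := fun k => a k i)).comp hn
      mem_Icc := fun w => abs_le.1 (ha1 (n w) i) }
  have hφ : ∀ w, ∑ i, (φ i).toFun w • L₀ • b i = g (n w) := by
    intro w
    simp only [smul_comm _ L₀, ← Finset.smul_sum]
    change L₀ • ∑ i, a (n w) i • b i = _
    rw [ha2, smul_inv_smul₀ hL₀.ne']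
  refine ⟨φ, fun i => L₀ • b i, fun D _ hint => ?_⟩
  have hφi : ∀ i, Integrable (φ i).toFun D := fun i =>
    Integrable.of_bound (φ i).measurable_toFun.aestronglyMeasurable 1
      (Filter.Eventually.of_forall fun w => abs_le.2 ((φ i).mem_Icc w))
  let G : EuclideanSpace ℝ (Fin d) := ∑ i, (∫ w, (φ i).toFun w ∂D) • L₀ • b i
  have hinn : ∀ w z, inner ℝ (g (n w)) z = ∑ i, (φ i).toFun w * inner ℝ (L₀ • b i) z := by
    intro w z
    rw [← hφ w, sum_inner]
    exact Finset.sum_congr rfl fun i _ => by rw [inner_smul_left]; rfl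
  have hinnint : ∀ z, Integrable (fun w => inner ℝ (g (n w)) z) D := fun z => by
    simp only [hinn]
    exact integrable_finsetSum _ fun i _ => (hφi i).mul_const _
  have hG : ∀ z, inner ℝ G z = ∫ w, inner ℝ (g (n w)) z ∂D := by
    intro z
    simp only [hinn]
    rw [integral_finsetSum _ fun i _ => (hφi i).mul_const _]
    simp only [integral_mul_const, G, sum_inner]
    exact Finset.sum_congr rfl fun i _ => by rw [inner_smul_left]; rfl
  refine ⟨G, fun z => ?_, fun y hy => ?_, fun τ hτ v hv => ?_⟩
  · rw [hG]
    have h1 : ∫ _w, -(L₀ * ‖z‖) ∂D = -(L₀ * ‖z‖) := by simp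
    rw [← h1]
    refine integral_mono (integrable_const _) (hinnint z) fun w => ?_
    have h2 := (abs_le.1 (abs_real_inner_le_norm (g (n w)) z)).1
    have h3 := mul_le_mul_of_nonneg_right (hg (n w)) (norm_nonneg z)
    simp only
    linarith
  · rw [hG]
    have hA : Integrable (fun w => f x w + inner ℝ (g (n w)) (y - x)) D :=
      (hint x hx).add (hinnint _)
    have h1 : ∫ w, (f x w + inner ℝ (g (n w)) (y - x) - δ) ∂D =
        expectedObjective f D x + ∫ w, inner ℝ (g (n w)) (y - x) ∂D - δ := by
      rw [integral_sub hA (integrable_const _),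
        integral_add (hint x hx) (hinnint _)]
      simp [expectedObjective]
    rw [← h1]
    exact integral_mono (hA.sub (integrable_const _)) (hint y hy)
      fun w => hsub w y hy
  · rcases hτ.eq_or_lt with rfl | hτ
    · have : ∑ i, v i • L₀ • b i - G = 0 := by
        rw [sub_eq_zero]
        refine Finset.sum_congr rfl fun i _ => ?_
        rw [sub_eq_zero.1 (abs_nonpos_iff.1 (hv i))]
      rw [this]; simp
    -- The errors divided by `τ` are again coefficients in `[-1, 1]`, so the outer bound of the
    -- zonotope applies.
    · have h1 : ∑ i, v i • L₀ • b i - G =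
          (L₀ * τ) • ∑ i, ((v i - ∫ w, (φ i).toFun w ∂D) / τ) • b i := by
        simp only [G, ← Finset.sum_sub_distrib, Finset.smul_sum, ← sub_smul, smul_smul]
        refine Finset.sum_congr rfl fun i _ => ?_
        congr 1
        field_simp
      have h2 := hb1 (fun i => (v i - ∫ w, (φ i).toFun w ∂D) / τ) fun i => by
        rw [abs_div, abs_of_pos hτ, div_le_one hτ]
        exact hv i
      rw [h1, norm_smul, Real.norm_of_nonneg (by positivity)]
      calc L₀ * τ * _ ≤ L₀ * τ * 384 := mul_le_mul_of_nonneg_left h2 (by positivity)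
        _ = _ := by ring

/-! ### Composing queries into algorithms -/

/-- Ask all queries of a finite family. -/
def SQAlgorithm.queryAll {W : Type u} [MeasurableSpace W] {X : Type v} :
    (n : ℕ) → (Fin n → StatQuery W) → ((Fin n → ℝ) → SQAlgorithm W X) → SQAlgorithm W X
  | 0, _, k => k fun i => i.elim0
  | n + 1, φ, k => .query (φ 0) fun r =>
      SQAlgorithm.queryAll n (fun i => φ i.succ) fun rs => k (Fin.cons r rs)

theorem SQRun.of_queryAll {W : Type u} [MeasurableSpace W] {X : Type v} {D : Measure W} {τ : ℝ}
    {n : ℕ} {φ : Fin n → StatQuery W} {k : (Fin n → ℝ) → SQAlgorithm W X} {m : ℕ} {x : X}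
    (h : SQRun D τ (SQAlgorithm.queryAll n φ k) m x) :
    ∃ r : Fin n → ℝ, (∀ i, |r i - ∫ w, (φ i).toFun w ∂D| ≤ τ) ∧
      ∃ m', m = n + m' ∧ SQRun D τ (k r) m' x := by
  induction n generalizing m with
  | zero => exact ⟨fun i => i.elim0, fun i => i.elim0, m, by simp, h⟩
  | succ n ih =>
    cases h with
    | query _ _ r m _ hr h =>
      obtain ⟨rs, hrs, m', rfl, h'⟩ := ih h
      refine ⟨Fin.cons r rs, fun i => ?_, m', by ring, h'⟩
      refine Fin.cases ?_ (fun i => ?_) i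
      · simpa using hr
      · simpa using hrs i

/-- Iterate `T` rounds, each asking a family of `N` queries and updating a state. -/
def SQAlgorithm.iterate {W : Type u} [MeasurableSpace W] {X S : Type v} {N : ℕ}
    (φ : S → Fin N → StatQuery W) (step : S → (Fin N → ℝ) → S) (out : S → X) :
    ℕ → S → SQAlgorithm W X
  | 0, s => .output (out s)
  | T + 1, s => SQAlgorithm.queryAll N (φ s) fun r =>
      SQAlgorithm.iterate φ step out T (step s r)

theorem SQRun.of_iterate {W : Type u} [MeasurableSpace W] {X S : Type v} {D : Measure W} {τ : ℝ}
    {N : ℕ} {φ : S → Fin N → StatQuery W} {step : S → (Fin N → ℝ) → S} {out : S → X}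
    (Inv : ℕ → S → Prop)
    (hstep : ∀ t s, Inv t s → ∀ r : Fin N → ℝ,
      (∀ i, |r i - ∫ w, (φ s i).toFun w ∂D| ≤ τ) → Inv (t + 1) (step s r))
    {T t : ℕ} {s : S} (hs : Inv t s) {m : ℕ} {x : X}
    (h : SQRun D τ (SQAlgorithm.iterate φ step out T s) m x) :
    m = T * N ∧ ∃ s', Inv (t + T) s' ∧ x = out s' := by
  induction T generalizing t s m with
  | zero =>
    cases h
    exact ⟨by simp, s, hs, rfl⟩
  | succ T ih =>
    obtain ⟨r, hr, m', rfl, h'⟩ := SQRun.of_queryAll h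
    obtain ⟨rfl, s', hs', rfl⟩ := ih (hstep t s hs r hr) h'
    exact ⟨by ring, s', by rwa [add_assoc, add_comm 1] at hs', rfl⟩

/-! ### Projected gradient descent with an inexact oracle -/

theorem exists_projection {E : Type*} [NormedAddCommGroup E] [InnerProductSpace ℝ E] {K : Set E}
    (hK : Convex ℝ K) (hc : IsCompact K) (hne : K.Nonempty) (u : E) :
    ∃ p ∈ K, ∀ z ∈ K, inner ℝ (u - p) (z - p) ≤ 0 := by
  obtain ⟨p, hp, h⟩ := exists_norm_eq_iInf_of_complete_convex hne hc.isComplete hK u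
  exact ⟨p, hp, (norm_eq_iInf_iff_real_inner_le_zero hK hp).1 h⟩

/-- The variational inequality of the projection, with the inner product of `x - x'` and `x' - y`
expanded into squared distances. -/
theorem inner_le_of_projection {E : Type*} [NormedAddCommGroup E] [InnerProductSpace ℝ E]
    {L : ℝ} (hL : 0 < L) {x x' y g : E}
    (h : inner ℝ (x - (1 / (2 * L)) • g - x') (y - x') ≤ 0) :
    inner ℝ g (x' - y) ≤ L * (‖x - y‖ ^ 2 - ‖x' - y‖ ^ 2 - ‖x' - x‖ ^ 2) := by
  have h1 : x - (1 / (2 * L)) • g - x' = (x - x') - (1 / (2 * L)) • g := by abel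
  rw [h1, inner_sub_left, inner_smul_left, ← neg_sub x' y, inner_neg_right, inner_neg_right] at h
  simp only [conj_trivial] at h
  have h2 : ‖x - y‖ ^ 2 = ‖x - x'‖ ^ 2 + 2 * inner ℝ (x - x') (x' - y) + ‖x' - y‖ ^ 2 := by
    rw [← norm_add_sq_real, sub_add_sub_cancel]
  rw [norm_sub_rev x' x, h2]
  have h3 : 1 / (2 * L) * inner ℝ g (x' - y) ≤ inner ℝ (x - x') (x' - y) := by linarith
  rw [one_div, inv_mul_le_iff₀ (by positivity)] at h3
  linarith

/-- One step of projected gradient descent with an inexact oracle. -/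
theorem projected_step_le {E : Type*} [NormedAddCommGroup E] [InnerProductSpace ℝ E]
    {L κ ε : ℝ} (hκ : 0 < κ) (hκL : κ ≤ L) (hε : 0 < ε) {F : E → ℝ} {x x' y g G : E}
    (hlow : F x + inner ℝ G (y - x) + κ / 4 * ‖y - x‖ ^ 2 - ε / 8 ≤ F y)
    (hup : F x' ≤ F x + inner ℝ G (x' - x) + L / 2 * ‖x' - x‖ ^ 2 + ε / 8)
    (hg : ‖g - G‖ ≤ Real.sqrt (κ * ε) / 4)
    (h : inner ℝ (x - (1 / (2 * L)) • g - x') (y - x') ≤ 0) :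
    F x' - F y - ε / 2 + L * ‖x' - y‖ ^ 2 ≤ (1 - κ / (8 * L)) * (L * ‖x - y‖ ^ 2) := by
  have hL : 0 < L := hκ.trans_le hκL
  have h1 := inner_le_of_projection hL h
  have h2 : inner ℝ G (x' - x) - inner ℝ G (y - x) =
      inner ℝ g (x' - y) - inner ℝ (g - G) (x' - y) := by
    rw [← inner_sub_right, ← inner_sub_left, sub_sub_sub_cancel_right, sub_sub_cancel]
  set a := ‖x - y‖ with ha
  set b := ‖x' - x‖ with hb
  set σ := Real.sqrt (κ * ε) / 4 with hσ
  have hσ0 : 0 ≤ σ := by positivity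
  have hσ2 : σ ^ 2 = κ * ε / 16 := by
    rw [hσ, div_pow, Real.sq_sqrt (by positivity)]; norm_num
  have h3 : -inner ℝ (g - G) (x' - y) ≤ σ * (a + b) := by
    have h4 : ‖x' - y‖ ≤ a + b := by
      have : x' - y = (x - y) + (x' - x) := by abel
      rw [this]; exact norm_add_le _ _
    have h5 := (abs_le.1 (abs_real_inner_le_norm (g - G) (x' - y))).1
    have h6 := mul_le_mul hg h4 (norm_nonneg _) hσ0
    linarith
  -- Half of the strong convexity term `κ / 4` absorbs the noise; the other half gives the
  -- contraction.
  have h4 : σ * a ≤ κ / 8 * a ^ 2 + ε / 8 := by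
    have h5 : 0 ≤ κ / 8 * (a - 4 * σ / κ) ^ 2 := by positivity
    have h6 : κ / 8 * (a - 4 * σ / κ) ^ 2 = κ / 8 * a ^ 2 - σ * a + 2 * σ ^ 2 / κ := by
      field_simp; ring
    have h7 : 2 * σ ^ 2 / κ = ε / 8 := by rw [hσ2]; field_simp; norm_num
    linarith
  -- The step size `1 / (2 * L)` yields `-L * b ^ 2`: one half cancels the curvature term, the other
  -- half this noise.
  have h5 : σ * b ≤ L / 2 * b ^ 2 + ε / 32 := by
    have h5 : 0 ≤ L / 2 * (b - σ / L) ^ 2 := by positivity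
    have h6 : L / 2 * (b - σ / L) ^ 2 = L / 2 * b ^ 2 - σ * b + σ ^ 2 / (2 * L) := by
      field_simp; ring
    have h7 : σ ^ 2 / (2 * L) ≤ ε / 32 := by
      rw [hσ2, div_le_div_iff₀ (by positivity) (by norm_num)]
      nlinarith
    linarith
  have h6 : (1 - κ / (8 * L)) * (L * a ^ 2) = L * a ^ 2 - κ / 8 * a ^ 2 := by field_simp
  rw [norm_sub_rev y x, ← ha] at hlow
  rw [h6]
  linarith

theorem log_decay {L κ ε R : ℝ} (hκ : 0 < κ) (hκL : κ ≤ L) (hε : 0 < ε) (hR : 0 ≤ R) {T : ℕ}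
    (hT : 8 * L / κ * max 1 (Real.log (8 * L * R ^ 2 / ε)) ≤ T) :
    (1 - κ / (8 * L)) ^ T * (L * (2 * R) ^ 2) ≤ ε / 2 := by
  have hL : 0 < L := hκ.trans_le hκL
  rcases hR.eq_or_lt with rfl | hR
  · simp; positivity
  have hq : 0 ≤ 1 - κ / (8 * L) := by
    rw [sub_nonneg, div_le_one (by positivity)]; linarith
  have h1 : (1 - κ / (8 * L)) ^ T ≤ Real.exp (-(κ / (8 * L) * T)) := by
    have := pow_le_pow_left₀ hq (Real.one_sub_le_exp_neg (κ / (8 * L))) T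
    rwa [← Real.exp_nat_mul, mul_neg, mul_comm (T : ℝ)] at this
  have ha : 0 < 8 * L * R ^ 2 / ε := by positivity
  have h2 : Real.log (8 * L * R ^ 2 / ε) ≤ κ / (8 * L) * T := by
    have h3 := mul_le_mul_of_nonneg_left hT (by positivity : 0 ≤ κ / (8 * L))
    have h4 : κ / (8 * L) * (8 * L / κ * max 1 (Real.log (8 * L * R ^ 2 / ε))) =
        max 1 (Real.log (8 * L * R ^ 2 / ε)) := by field_simp
    rw [h4] at h3
    exact (le_max_right _ _).trans h3
  have h3 : (1 - κ / (8 * L)) ^ T ≤ (8 * L * R ^ 2 / ε)⁻¹ := by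
    refine h1.trans ?_
    rw [← Real.exp_log ha, ← Real.exp_neg]
    exact Real.exp_le_exp.2 (by linarith)
  refine (mul_le_mul_of_nonneg_right h3 (by positivity)).trans (le_of_eq ?_)
  field_simp
  norm_num

theorem dist_le_two_radius {d : ℕ} {K : Set (EuclideanSpace ℝ (Fin d))} (hK : IsCompact K)
    {x y : EuclideanSpace ℝ (Fin d)} (hx : x ∈ K) (hy : y ∈ K) : ‖x - y‖ ≤ 2 * radius K := by
  rw [← dist_eq_norm, radius]
  linarith [Metric.dist_le_diam_of_mem hK.isBounded hx hy]

theorem radius_nonneg {d : ℕ} (K : Set (EuclideanSpace ℝ (Fin d))) : 0 ≤ radius K :=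
  div_nonneg Metric.diam_nonneg zero_le_two

/-- State of averaged projected gradient descent: the iterate, the average and its weight. -/
noncomputable def averagedStep {E : Type*} [NormedAddCommGroup E] [InnerProductSpace ℝ E]
    (proj : E → E) (L q : ℝ) (s : E × E × ℝ) (g : E) : E × E × ℝ :=
  (proj (s.1 - (1 / (2 * L)) • g),
    (q * s.2.2 / (q * s.2.2 + 1)) • s.2.1 +
      (1 / (q * s.2.2 + 1)) • proj (s.1 - (1 / (2 * L)) • g),
    q * s.2.2 + 1)

/-- Averaged projected gradient descent with an inexact first-order oracle that is implemented by
`N` statistical queries. -/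
theorem exists_solver {d : ℕ} {K : Set (EuclideanSpace ℝ (Fin d))} (hK : Convex ℝ K)
    (hKc : IsCompact K) (hne : K.Nonempty) {W : Type u} [MeasurableSpace W]
    {L κ ε : ℝ} (hκ : 0 < κ) (hκL : κ ≤ L) (hε : 0 < ε) {N : ℕ}
    (φ : EuclideanSpace ℝ (Fin d) → Fin N → StatQuery W)
    (est : EuclideanSpace ℝ (Fin d) → (Fin N → ℝ) → EuclideanSpace ℝ (Fin d)) :
    ∃ A : SQAlgorithm W (EuclideanSpace ℝ (Fin d)),
      ∀ (D : Measure W) (τ : ℝ) (F : EuclideanSpace ℝ (Fin d) → ℝ), ConvexOn ℝ K F →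
        (∀ x ∈ K, ∃ G : EuclideanSpace ℝ (Fin d),
          (∀ y ∈ K, F x + inner ℝ G (y - x) + κ / 4 * ‖y - x‖ ^ 2 - ε / 8 ≤ F y) ∧
          (∀ y ∈ K, F y ≤ F x + inner ℝ G (y - x) + L / 2 * ‖y - x‖ ^ 2 + ε / 8) ∧
          ∀ r : Fin N → ℝ, (∀ i, |r i - ∫ w, (φ x i).toFun w ∂D| ≤ τ) →
            ‖est x r - G‖ ≤ Real.sqrt (κ * ε) / 4) →
        A.Solves D τ (N * (16 * L / κ * max 1 (Real.log (8 * L * radius K ^ 2 / ε))))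
          (IsEpsOptimal K F ε) := by
  have hL : 0 < L := hκ.trans_le hκL
  obtain ⟨x0, hx0⟩ := hne
  choose proj hproj hproj' using exists_projection hK hKc ⟨x0, hx0⟩
  set q := 1 - κ / (8 * L) with hq
  have hq0 : 0 ≤ q := by
    rw [hq, sub_nonneg, div_le_one (by positivity)]; linarith
  set M := max 1 (Real.log (8 * L * radius K ^ 2 / ε)) with hM
  have hM1 : 1 ≤ M := le_max_left _ _
  have hLκ : 1 ≤ L / κ := (one_le_div hκ).2 hκL
  have hLM : 1 ≤ L / κ * M := by nlinarith
  set T := ⌈8 * L / κ * M⌉₊ with hT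
  have hT1 : 1 ≤ T := by
    rw [hT, Nat.one_le_ceil_iff]
    have : 8 * L / κ * M = 8 * (L / κ * M) := by ring
    linarith
  -- The starting weight `0` removes `x0` from the average; later iterates receive geometric weights
  -- with ratio `q`.
  refine ⟨SQAlgorithm.iterate (fun s : _ × _ × ℝ => φ s.1)
    (fun s r => averagedStep proj L q s (est s.1 r)) (fun s => s.2.1) T (x0, x0, 0), ?_⟩
  intro D τ F hF horacle m z hrun
  -- The potential combines the weighted gap of the average with the distance to `y`. A final weight
  -- of at least `1` turns it into a bound on the gap, hence at least one round is needed.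
  let Inv : ℕ → EuclideanSpace ℝ (Fin d) × EuclideanSpace ℝ (Fin d) × ℝ → Prop := fun t s =>
    s.1 ∈ K ∧ s.2.1 ∈ K ∧ 0 ≤ s.2.2 ∧ (1 ≤ t → 1 ≤ s.2.2) ∧
      ∀ y ∈ K, s.2.2 * (F s.2.1 - F y - ε / 2) + L * ‖s.1 - y‖ ^ 2 ≤
        q ^ t * (L * ‖x0 - y‖ ^ 2)
  have hInv0 : Inv 0 (x0, x0, 0) := ⟨hx0, hx0, le_rfl, by simp, fun y _ => by simp⟩
  have hstep : ∀ t s, Inv t s → ∀ r : Fin N → ℝ,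
      (∀ i, |r i - ∫ w, (φ s.1 i).toFun w ∂D| ≤ τ) →
      Inv (t + 1) (averagedStep proj L q s (est s.1 r)) := by
    rintro t ⟨x, z, S⟩ ⟨hx, hz, hS, -, hpot⟩ r hr
    simp only at hx hz hS hpot hr
    obtain ⟨G, hlow, hup, hest⟩ := horacle x hx
    simp only [averagedStep]
    set x' := proj (x - (1 / (2 * L)) • est x r) with hx'
    have hx'K : x' ∈ K := hproj _
    have hqS : 0 ≤ q * S := mul_nonneg hq0 hS
    have hpos : 0 < q * S + 1 := by linarith
    have hab : q * S / (q * S + 1) + 1 / (q * S + 1) = 1 := by field_simp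
    have ha0 : 0 ≤ q * S / (q * S + 1) := by positivity
    have hb0 : 0 ≤ 1 / (q * S + 1) := by positivity
    refine ⟨hx'K, hK hz hx'K ha0 hb0 hab, hpos.le, fun _ => by linarith, fun y hy => ?_⟩
    have h1 := projected_step_le hκ hκL hε (hlow y hy) (hup x' hx'K) (hest r hr)
      (hproj' _ y hy)
    have h2 := hF.2 hz hx'K ha0 hb0 hab
    simp only [smul_eq_mul] at h2
    have h3 := mul_le_mul_of_nonneg_left h2 hpos.le
    have h4 : (q * S + 1) * (q * S / (q * S + 1) * F z + 1 / (q * S + 1) * F x') =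
        q * S * F z + F x' := by field_simp
    rw [h4] at h3
    have h5 := mul_le_mul_of_nonneg_left (hpot y hy) hq0
    rw [pow_succ' q t]
    linarith
  obtain ⟨rfl, ⟨x, z', S⟩, ⟨-, hz, -, hS, hpot⟩, rfl⟩ :=
    SQRun.of_iterate Inv hstep hInv0 hrun
  simp only [zero_add] at hz hS hpot
  refine ⟨?_, hz, fun y hy => ?_⟩
  · push_cast
    rw [mul_comm]
    refine mul_le_mul_of_nonneg_left ?_ (Nat.cast_nonneg N)
    have h1 := (Nat.ceil_lt_add_one (show 0 ≤ 8 * L / κ * M by positivity)).le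
    have h2 : 8 * L / κ * M = 8 * (L / κ * M) := by ring
    have h3 : 16 * L / κ * M = 16 * (L / κ * M) := by ring
    linarith
  · have h1 := log_decay hκ hκL hε (radius_nonneg K) (Nat.le_ceil _ : 8 * L / κ * M ≤ T)
    have h2 : ‖x0 - y‖ ^ 2 ≤ (2 * radius K) ^ 2 :=
      pow_le_pow_left₀ (norm_nonneg _) (dist_le_two_radius hKc hx0 hy) 2
    have h3 : q ^ T * (L * ‖x0 - y‖ ^ 2) ≤ q ^ T * (L * (2 * radius K) ^ 2) := by gcongr
    have h4 := hpot y hy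
    have h5 := hS hT1
    have h6 : 0 ≤ L * ‖x - y‖ ^ 2 := by positivity
    by_contra! h7
    nlinarith

/-! ### Consequences of strong convexity and of Lipschitz gradients -/

theorem strongConvexOn_convexOn {E : Type*} [NormedAddCommGroup E] [InnerProductSpace ℝ E]
    {K : Set E} {κ : ℝ} (hκ : 0 ≤ κ) {F : E → ℝ} (hF : StrongConvexOn K κ F) :
    ConvexOn ℝ K F :=
  strongConvexOn_zero.1 (hF.mono hκ)

theorem strongConvexOn_midpoint {E : Type*} [NormedAddCommGroup E] [InnerProductSpace ℝ E]
    {K : Set E} {κ : ℝ} {F : E → ℝ} (hF : StrongConvexOn K κ F) {x y : E} (hx : x ∈ K)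
    (hy : y ∈ K) :
    midpoint ℝ x y ∈ K ∧ F (midpoint ℝ x y) ≤ F x / 2 + F y / 2 - κ / 8 * ‖y - x‖ ^ 2 := by
  have hm : midpoint ℝ x y = (1 / 2 : ℝ) • x + (1 / 2 : ℝ) • y := by
    rw [midpoint_eq_smul_add, smul_add]; norm_num
  have h := hF.2 hx hy (by norm_num : (0 : ℝ) ≤ 1 / 2) (by norm_num : (0 : ℝ) ≤ 1 / 2)
    (by norm_num)
  rw [hm]
  refine ⟨hF.1 hx hy (by norm_num) (by norm_num) (by norm_num), ?_⟩
  simp only [smul_eq_mul] at h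
  rw [norm_sub_rev y x]
  linarith

/-- Approximate subgradients of a strongly convex function give a quadratic lower bound. -/
theorem strongConvexOn_quadratic_lower {E : Type*} [NormedAddCommGroup E]
    [InnerProductSpace ℝ E] {K : Set E} {κ δ : ℝ} {F : E → ℝ} (hF : StrongConvexOn K κ F)
    {x G : E} (hx : x ∈ K) (hG : ∀ y ∈ K, F x + inner ℝ G (y - x) - δ ≤ F y) :
    ∀ y ∈ K, F x + inner ℝ G (y - x) + κ / 4 * ‖y - x‖ ^ 2 - 2 * δ ≤ F y := by
  intro y hy
  obtain ⟨hmK, hm⟩ := strongConvexOn_midpoint hF hx hy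
  -- Doubling the inequality at the midpoint turns `δ` into `2 * δ` and the midpoint gain `κ / 8`
  -- into `κ / 4`.
  have h := hG _ hmK
  rw [midpoint_sub_left, inner_smul_right] at h
  norm_num at h
  linarith

theorem expectedObjective_sub_le {d : ℕ} {K : Set (EuclideanSpace ℝ (Fin d))} {W : Type u}
    [MeasurableSpace W] {f : EuclideanSpace ℝ (Fin d) → W → ℝ} {L₀ : ℝ}
    (hf : ∀ w, IsConvexLipschitz K L₀ fun x => f x w) {D : Measure W} [IsProbabilityMeasure D]
    (hint : ∀ x ∈ K, Integrable (f x) D) {x y : EuclideanSpace ℝ (Fin d)} (hx : x ∈ K)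
    (hy : y ∈ K) :
    expectedObjective f D x - expectedObjective f D y ≤ L₀ * ‖x - y‖ := by
  rw [expectedObjective, expectedObjective, ← integral_sub (hint x hx) (hint y hy)]
  have h : ∫ _w, L₀ * ‖x - y‖ ∂D = L₀ * ‖x - y‖ := by simp
  rw [← h]
  exact integral_mono ((hint x hx).sub (hint y hy)) (integrable_const _) fun w =>
    (abs_le.1 ((hf w).2 x hx y hy)).2

/-- A strongly convex Lipschitz function has bounded oscillation. -/
theorem sub_le_of_strongConvexOn_of_lipschitz {E : Type*} [NormedAddCommGroup E]
    [InnerProductSpace ℝ E] {K : Set E} {κ L₀ : ℝ} (hκ : 0 < κ) (hL₀ : 0 < L₀) {F : E → ℝ}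
    (hF : StrongConvexOn K κ F) (hlip : ∀ x ∈ K, ∀ y ∈ K, F x - F y ≤ L₀ * ‖x - y‖) {x y : E}
    (hx : x ∈ K) (hy : y ∈ K) : F x - F y ≤ 4 * L₀ ^ 2 / κ := by
  obtain ⟨hmK, hm⟩ := strongConvexOn_midpoint hF hx hy
  have h1 := hlip x hx _ hmK
  have h2 := hlip y hy _ hmK
  rw [left_sub_midpoint, norm_smul] at h1
  rw [right_sub_midpoint, norm_smul] at h2
  have h3 := hlip x hx y hy
  rw [norm_sub_rev x y] at h1 h3
  norm_num at h1 h2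
  set r := ‖y - x‖ with hr
  -- The midpoint lies within `r / 2` of both ends, so the convexity gain `κ / 8 * r ^ 2` is at most
  -- `L₀ * r / 2`.
  have h4 : κ * r * r ≤ 4 * L₀ * r := by nlinarith
  have h5 : κ * r ≤ 4 * L₀ := by
    rcases (norm_nonneg (y - x)).eq_or_lt with h | h
    · rw [hr, ← h]; simp; positivity
    · exact le_of_mul_le_mul_right h4 h
  refine h3.trans ?_
  rw [le_div_iff₀ hκ]
  nlinarith

/-- Differentiation along the segment from `x` to `y`, which stays in `K`, uses one-sided slopes
only and so covers boundary points. -/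
theorem inner_gradient_le_sub {E : Type*} [NormedAddCommGroup E] [InnerProductSpace ℝ E]
    [CompleteSpace E] {K : Set E} {F : E → ℝ} (hF : ConvexOn ℝ K F) {x y g : E} (hx : x ∈ K)
    (hy : y ∈ K) (hg : HasGradientWithinAt F g K x) : F x + inner ℝ g (y - x) ≤ F y := by
  have hline : HasDerivWithinAt (fun t : ℝ => x + t • (y - x)) (y - x) (Set.Icc 0 1) 0 := by
    simpa using (((hasDerivAt_id (0 : ℝ)).smul_const (y - x)).const_add x).hasDerivWithinAt
  have hmem : ∀ t ∈ Set.Icc (0 : ℝ) 1, x + t • (y - x) ∈ K := fun t ht =>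
    hF.1.add_smul_sub_mem hx hy ht
  have hg' : HasFDerivWithinAt F (InnerProductSpace.toDual ℝ E g) K (x + (0 : ℝ) • (y - x)) := by
    simpa using hg.hasFDerivWithinAt
  have h1 := hg'.comp_hasDerivWithinAt (0 : ℝ) hline hmem
  rw [InnerProductSpace.toDual_apply_apply, hasDerivWithinAt_iff_tendsto_slope] at h1
  have hIcc : Set.Icc (0 : ℝ) 1 \ {0} = Set.Ioc 0 1 := Set.Icc_sdiff_left
  rw [hIcc] at h1
  have hne : (nhdsWithin (0 : ℝ) (Set.Ioc 0 1)).NeBot := by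
    rw [nhdsWithin_Ioc_eq_nhdsGT zero_lt_one]
    infer_instance
  have h2 : inner ℝ g (y - x) ≤ F y - F x := by
    refine le_of_tendsto h1 ?_
    filter_upwards [self_mem_nhdsWithin] with t ht
    have h3 := hF.2 hx hy (by linarith [ht.2] : 0 ≤ 1 - t) ht.1.le (by ring)
    have h4 : (1 - t) • x + t • y = x + t • (y - x) := by
      rw [sub_smul, one_smul, smul_sub]; abel
    rw [h4] at h3
    simp only [smul_eq_mul] at h3
    rw [slope_def_field]
    simp only [Function.comp, zero_smul, add_zero, sub_zero]
    rw [div_le_iff₀ ht.1]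
    linarith
  linarith

/-- At a point around which `K` contains a ball, approximate subgradients of a convex function with
Lipschitz gradient are close to the gradient. -/
theorem norm_sub_gradient_le {E : Type*} [NormedAddCommGroup E] [InnerProductSpace ℝ E]
    {K : Set E} {F : E → ℝ} {L₁ r : ℝ} (hr : 0 < r) {x G : E} {g : E → E}
    (hconv : ∀ x ∈ K, ∀ y ∈ K, F x + inner ℝ (g x) (y - x) ≤ F y)
    (hlip : ∀ x ∈ K, ∀ y ∈ K, ‖g x - g y‖ ≤ L₁ * ‖x - y‖) (hball : ∀ u, ‖u‖ ≤ r → x + u ∈ K)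
    (hG : ∀ y ∈ K, F x + inner ℝ G (y - x) - L₁ * r ^ 2 ≤ F y) :
    ‖G - g x‖ ≤ 2 * L₁ * r := by
  have hx : x ∈ K := by simpa using hball 0 (by simpa using hr.le)
  rcases eq_or_ne (G - g x) 0 with h0 | h0
  · have h1 := hG x hx
    simp only [sub_self, inner_zero_right, add_zero] at h1
    have h2 : 0 ≤ (L₁ * r) * r := by nlinarith
    rw [h0, norm_zero]
    linarith [le_of_mul_le_mul_right (by simpa using h2 : 0 * r ≤ (L₁ * r) * r) hr]
  · have hn : 0 < ‖G - g x‖ := norm_pos_iff.2 h0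
    -- The test point lies in the direction of the discrepancy. There `F (x + u) - F x` is at most
    -- the inner product of `g (x + u)` with `u`, hence of `g x` with `u` plus `L₁ * r ^ 2`.
    set u := (r / ‖G - g x‖) • (G - g x) with hu
    have hun : ‖u‖ = r := by
      rw [hu, norm_smul, Real.norm_of_nonneg (by positivity), div_mul_cancel₀ _ hn.ne']
    have huK := hball u hun.le
    have h1 := hG _ huK
    have h2 := hconv _ huK x hx
    have h3 := hlip _ huK x hx
    rw [add_sub_cancel_left] at h1 h3
    rw [sub_add_cancel_left, inner_neg_right] at h2
    have h4 := (abs_le.1 (abs_real_inner_le_norm (g (x + u) - g x) u)).2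
    have h5 := mul_le_mul_of_nonneg_right h3 (norm_nonneg u)
    rw [inner_sub_left] at h4
    have h6 : inner ℝ (G - g x) u = r * ‖G - g x‖ := by
      rw [hu, inner_smul_right, real_inner_self_eq_norm_mul_norm]
      field_simp
    rw [inner_sub_left] at h6
    rw [hun] at h4 h5
    have h7 : ‖G - g x‖ * r ≤ (2 * L₁ * r) * r := by nlinarith
    exact le_of_mul_le_mul_right h7 hr

/-! ### Constants and trivial algorithms -/

theorem max_one_log_mul_le {a b m : ℝ} (ha : 0 < a) (hb : 0 ≤ b) (hm : 0 ≤ m)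
    (h : Real.log a ≤ m) :
    max 1 (Real.log (a * b)) ≤ (1 + m) * max 1 (Real.log b) := by
  have h1 : 1 ≤ max 1 (Real.log b) := le_max_left _ _
  have h2 : Real.log b ≤ max 1 (Real.log b) := le_max_right _ _
  refine max_le (by nlinarith) ?_
  rcases hb.eq_or_lt with rfl | hb
  · simp; positivity
  · rw [Real.log_mul ha.ne' hb.ne']
    nlinarith

theorem log_sixteen_le : Real.log 16 ≤ 3 := by
  rw [Real.log_le_iff_le_exp (by norm_num)]
  have h : (Real.exp 1) ^ 3 = Real.exp 3 := by rw [← Real.exp_nat_mul]; norm_num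
  rw [← h]
  exact le_trans (by norm_num) (pow_le_pow_left₀ (by norm_num) Real.exp_one_gt_d9.le 3)

theorem log_onehundredtwentyeight_le : Real.log 128 ≤ 5 := by
  rw [Real.log_le_iff_le_exp (by norm_num)]
  have h : (Real.exp 1) ^ 5 = Real.exp 5 := by rw [← Real.exp_nat_mul]; norm_num
  rw [← h]
  exact le_trans (by norm_num) (pow_le_pow_left₀ (by norm_num) Real.exp_one_gt_d9.le 5)

/-- The constant zero query. -/
def StatQuery.zero (W : Type u) [MeasurableSpace W] : StatQuery W where
  toFun _ := 0
  measurable_toFun := measurable_const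
  mem_Icc _ := by simp

/-- The algorithm that stops at once. -/
theorem solves_output {W : Type u} [MeasurableSpace W] {X : Type v} {D : Measure W} {τ N : ℝ}
    {good : X → Prop} {x : X} (hN : 0 ≤ N) (hx : good x) :
    (SQAlgorithm.output x : SQAlgorithm W X).Solves D τ N good := by
  intro n y h
  cases h
  exact ⟨by simpa using hN, hx⟩

theorem SQAlgorithm.Solves.mono {W : Type u} [MeasurableSpace W] {X : Type v}
    {A : SQAlgorithm W X} {D : Measure W} {τ N N' : ℝ} {good : X → Prop} (h : A.Solves D τ N good)
    (hN : N ≤ N') : A.Solves D τ N' good :=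
  fun n x hr => ⟨(h n x hr).1.trans hN, (h n x hr).2⟩

theorem oracle_tolerance {L₀ κ ε : ℝ} (hL₀ : 0 < L₀) :
    384 * L₀ * (1 / 3072 * (Real.sqrt (ε * κ) / L₀)) = Real.sqrt (κ * ε) / 8 := by
  rw [mul_comm ε κ]
  field_simp
  ring

/-! ### The two algorithms -/

theorem exists_algorithm_nonsmooth {d : ℕ} {K : Set (EuclideanSpace ℝ (Fin d))}
    (hK : IsConvexBody K) {W : Type u} [MeasurableSpace W] {f : EuclideanSpace ℝ (Fin d) → W → ℝ}
    {L₀ κ ε : ℝ} (hL₀ : 0 < L₀) (hκ : 0 < κ) (hε : 0 < ε) (hmeas : ∀ x ∈ K, Measurable (f x))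
    (hf : ∀ w, IsConvexLipschitz K L₀ fun x => f x w) :
    ∃ A : SQAlgorithm W (EuclideanSpace ℝ (Fin d)),
      ∀ (D : Measure W) [IsProbabilityMeasure D], (∀ x ∈ K, Integrable (f x) D) →
        StrongConvexOn K κ (expectedObjective f D) →
        A.Solves D (1 / 3072 * (Real.sqrt (ε * κ) / L₀))
          (1200000 * (d * (L₀ ^ 2 / (ε * κ)) * max 1 (Real.log (L₀ * radius K / ε))))
          (IsEpsOptimal K (expectedObjective f D) ε) := by
  obtain ⟨hKc, hKcomp, hKint⟩ := hK
  have hne : K.Nonempty := hKint.mono interior_subset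
  have hM : 1 ≤ max 1 (Real.log (L₀ * radius K / ε)) := le_max_left _ _
  -- The solver requires `κ ≤ L`. Otherwise the oscillation of the objective is below `ε` and any
  -- point will do.
  rcases lt_or_ge (16 * L₀ ^ 2 / ε) κ with hbig | hsmall
  · obtain ⟨x0, hx0⟩ := hne
    refine ⟨.output x0, fun D _ hint hF => solves_output (by positivity) ⟨hx0, fun y hy => ?_⟩⟩
    have h1 := sub_le_of_strongConvexOn_of_lipschitz hκ hL₀ hF
      (fun x hx y hy => expectedObjective_sub_le hf hint hx hy) hx0 hy
    rw [div_lt_iff₀ hε] at hbig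
    have h2 : 4 * L₀ ^ 2 / κ ≤ ε := by
      rw [div_le_iff₀ hκ]
      nlinarith [sq_nonneg L₀]
    linarith
  have hquery : ∀ x, ∃ (φ : Fin (384 * d) → StatQuery W)
      (b : Fin (384 * d) → EuclideanSpace ℝ (Fin d)), x ∈ K →
      ∀ (D : Measure W) [IsProbabilityMeasure D], (∀ y ∈ K, Integrable (f y) D) →
        ∃ G : EuclideanSpace ℝ (Fin d), (∀ z, -(L₀ * ‖z‖) ≤ inner ℝ G z) ∧
          (∀ y ∈ K, expectedObjective f D x + inner ℝ G (y - x) - ε / 16 ≤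
            expectedObjective f D y) ∧
          ∀ τ : ℝ, 0 ≤ τ → ∀ v : Fin (384 * d) → ℝ,
            (∀ i, |v i - ∫ w, (φ i).toFun w ∂D| ≤ τ) →
            ‖∑ i, v i • b i - G‖ ≤ 384 * L₀ * τ := by
    intro x
    by_cases hx : x ∈ K
    · obtain ⟨φ, b, h⟩ := exists_gradient_queries hKcomp hL₀ hmeas hf hx
        (by positivity : 0 < ε / 16)
      exact ⟨φ, b, fun _ => h⟩
    -- Dummy queries off `K`, where the solver never looks.
    · exact ⟨fun _ => StatQuery.zero W, fun _ => 0, fun h => absurd h hx⟩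
  choose φ b hφ using hquery
  obtain ⟨A, hA⟩ := exists_solver hKc hKcomp hne hκ hsmall hε φ
    fun x v => ∑ i, v i • b x i
  refine ⟨A, fun D _ hint hF => ?_⟩
  refine (hA D _ _ (strongConvexOn_convexOn hκ.le hF) fun x hx => ?_).mono ?_
  · obtain ⟨G, hG1, hG2, hG3⟩ := hφ x hx D hint
    refine ⟨G, fun y hy => ?_, fun y hy => ?_, fun v hv => ?_⟩
    · have := strongConvexOn_quadratic_lower hF hx hG2 y hy
      linarith
    · have h1 := expectedObjective_sub_le hf hint hy hx
      have h2 := hG1 (y - x)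
      -- Completing the square; this dictates `L = 16 * L₀ ^ 2 / ε`.
      have h3 : 2 * L₀ * ‖y - x‖ ≤ 16 * L₀ ^ 2 / ε / 2 * ‖y - x‖ ^ 2 + ε / 8 := by
        have h4 : 0 ≤ (8 * L₀ * ‖y - x‖ - ε) ^ 2 / (8 * ε) := by positivity
        have h5 : (8 * L₀ * ‖y - x‖ - ε) ^ 2 / (8 * ε) =
            16 * L₀ ^ 2 / ε / 2 * ‖y - x‖ ^ 2 + ε / 8 - 2 * L₀ * ‖y - x‖ := by
          field_simp; ring
        linarith
      linarith
    · have h1 := hG3 _ (by positivity) v hv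
      rw [oracle_tolerance hL₀] at h1
      have : 0 ≤ Real.sqrt (κ * ε) := Real.sqrt_nonneg _
      linarith
  · have hb : 0 ≤ L₀ * radius K / ε := by have := radius_nonneg K; positivity
    have e1 : 8 * (16 * L₀ ^ 2 / ε) * radius K ^ 2 / ε = 128 * (L₀ * radius K / ε) ^ 2 := by
      field_simp; ring
    have h1 : max 1 (Real.log (128 * (L₀ * radius K / ε) ^ 2)) ≤
        12 * max 1 (Real.log (L₀ * radius K / ε)) := by
      refine (max_one_log_mul_le (by norm_num) (sq_nonneg _) (by norm_num)
        log_onehundredtwentyeight_le).trans ?_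
      have h2 : max 1 (Real.log ((L₀ * radius K / ε) ^ 2)) ≤
          2 * max 1 (Real.log (L₀ * radius K / ε)) := by
        rw [Real.log_pow]
        refine max_le (by linarith) ?_
        push_cast
        linarith [le_max_right 1 (Real.log (L₀ * radius K / ε))]
      linarith
    rw [e1]
    push_cast
    calc 384 * (d : ℝ) * (16 * (16 * L₀ ^ 2 / ε) / κ *
          max 1 (Real.log (128 * (L₀ * radius K / ε) ^ 2)))
        ≤ 384 * (d : ℝ) * (16 * (16 * L₀ ^ 2 / ε) / κ *
          (12 * max 1 (Real.log (L₀ * radius K / ε)))) := by gcongr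
      _ = 1179648 * (d * (L₀ ^ 2 / (ε * κ)) * max 1 (Real.log (L₀ * radius K / ε))) := by
          field_simp; ring
      _ ≤ _ := by gcongr; norm_num

/-- At a boundary point an approximate subgradient may differ from the gradient by an outward
normal, and the upper model would fail. Subgradients are therefore queried at a point pulled
slightly into the interior, where they are close to the gradient. -/
theorem exists_algorithm_smooth {d : ℕ} {K : Set (EuclideanSpace ℝ (Fin d))}
    (hK : IsConvexBody K) {W : Type u} [MeasurableSpace W] {f : EuclideanSpace ℝ (Fin d) → W → ℝ}
    {L₀ L₁ κ ε : ℝ} (hL₀ : 0 < L₀) (hL₁ : 0 < L₁) (hκ : 0 < κ) (hε : 0 < ε)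
    (hmeas : ∀ x ∈ K, Measurable (f x)) (hf : ∀ w, IsConvexLipschitz K L₀ fun x => f x w) :
    ∃ A : SQAlgorithm W (EuclideanSpace ℝ (Fin d)),
      ∀ (D : Measure W) [IsProbabilityMeasure D], (∀ x ∈ K, Integrable (f x) D) →
        StrongConvexOn K κ (expectedObjective f D) →
        HasLipschitzGradient K L₁ (expectedObjective f D) →
        A.Solves D (1 / 3072 * (Real.sqrt (ε * κ) / L₀))
          (1200000 * (d * (L₁ / κ) * max 1 (Real.log (L₁ * radius K ^ 2 / ε))))
          (IsEpsOptimal K (expectedObjective f D) ε) := by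
  obtain ⟨hKc, hKcomp, hKint⟩ := hK
  have hne : K.Nonempty := hKint.mono interior_subset
  have hM : 1 ≤ max 1 (Real.log (L₁ * radius K ^ 2 / ε)) := le_max_left _ _
  have hgrad : ∀ {F : EuclideanSpace ℝ (Fin d) → ℝ}
      {g : EuclideanSpace ℝ (Fin d) → EuclideanSpace ℝ (Fin d)}, StrongConvexOn K κ F →
      (∀ x ∈ K, HasGradientWithinAt F (g x) K x) →
      ∀ x ∈ K, ∀ y ∈ K, F x + inner ℝ (g x) (y - x) + κ / 4 * ‖y - x‖ ^ 2 ≤ F y := by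
    intro F g hF hg x hx y hy
    have h := strongConvexOn_quadratic_lower (δ := 0) hF hx (G := g x) (fun z hz => by
      rw [sub_zero]
      exact inner_gradient_le_sub (strongConvexOn_convexOn hκ.le hF) hx hz (hg x hx)) y hy
    linarith
  -- If `κ > 2 * L₁`, the monotonicity constant `κ / 2` of the gradient exceeds its Lipschitz
  -- constant, so `K` is a single point.
  rcases lt_or_ge (2 * L₁) κ with hbig | hsmall
  · obtain ⟨x0, hx0⟩ := hne
    refine ⟨.output x0, fun D _ hint hF hG => solves_output (by positivity) ⟨hx0, fun y hy => ?_⟩⟩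
    obtain ⟨g, hg, hlip⟩ := hG
    have h1 := hgrad hF hg x0 hx0 y hy
    have h2 := hgrad hF hg y hy x0 hx0
    have h3 := real_inner_le_norm (g y - g x0) (y - x0)
    have h4 := mul_le_mul_of_nonneg_right (hlip y hy x0 hx0) (norm_nonneg (y - x0))
    rw [← neg_sub y x0, inner_neg_right, norm_neg] at h2
    rw [inner_sub_left] at h3
    have h5 : (κ / 2 - L₁) * ‖y - x0‖ ^ 2 ≤ 0 := by nlinarith
    have h6 : ‖y - x0‖ ^ 2 ≤ 0 := by
      by_contra! h
      nlinarith
    have h7 : y = x0 := by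
      rw [← sub_eq_zero, ← norm_eq_zero]
      exact pow_eq_zero_iff two_ne_zero |>.1 (le_antisymm h6 (sq_nonneg _))
    rw [h7]; linarith
  obtain ⟨x0, hx0⟩ := hKint
  obtain ⟨ρ, hρ, hball⟩ := Metric.nhds_basis_closedBall.mem_iff.1 (mem_interior_iff_mem_nhds.1 hx0)
  have hx0K : x0 ∈ K := interior_subset hx0
  set σ := Real.sqrt (κ * ε) / 8 with hσ
  have hσ0 : 0 < σ := by have := Real.sqrt_pos.2 (mul_pos hκ hε); positivity
  have hR := radius_nonneg K
  -- The shift `s` makes the gradient's change plus the subgradient error at most `σ`; the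
  -- statistical error contributes another `σ`, for a total of `√(κ * ε) / 4`.
  set s := min 1 (σ / (L₁ * (2 * radius K + 2 * ρ))) with hs
  have hs0 : 0 < s := lt_min one_pos (by positivity)
  have hs1 : s ≤ 1 := min_le_left _ _
  have hsσ : L₁ * (s * (2 * radius K)) + 2 * L₁ * (s * ρ) ≤ σ := by
    have h := min_le_right 1 (σ / (L₁ * (2 * radius K + 2 * ρ)))
    rw [← hs, le_div_iff₀ (by positivity)] at h
    linarith
  have hshift : ∀ x ∈ K, ∀ u, ‖u‖ ≤ s * ρ → x + s • (x0 - x) + u ∈ K := by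
    intro x hx u hu
    have h1 : x0 + s⁻¹ • u ∈ K := hball (by
      rw [Metric.mem_closedBall, dist_eq_norm, add_sub_cancel_left, norm_smul,
        Real.norm_of_nonneg (inv_pos.2 hs0).le, inv_mul_le_iff₀ hs0]
      exact hu)
    have h2 := hKc.add_smul_sub_mem hx h1 ⟨hs0.le, hs1⟩
    have h3 : x + s • (x0 + s⁻¹ • u - x) = x + s • (x0 - x) + u := by
      rw [add_sub_right_comm, smul_add, smul_inv_smul₀ hs0.ne', add_assoc]
    rwa [h3] at h2
  have hshiftK : ∀ x ∈ K, x + s • (x0 - x) ∈ K := fun x hx =>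
    hKc.add_smul_sub_mem hx hx0K ⟨hs0.le, hs1⟩
  have hr0 : 0 < s * ρ := mul_pos hs0 hρ
  have hquery : ∀ x, ∃ (φ : Fin (384 * d) → StatQuery W)
      (b : Fin (384 * d) → EuclideanSpace ℝ (Fin d)), x ∈ K →
      ∀ (D : Measure W) [IsProbabilityMeasure D], (∀ y ∈ K, Integrable (f y) D) →
        ∃ G : EuclideanSpace ℝ (Fin d), (∀ z, -(L₀ * ‖z‖) ≤ inner ℝ G z) ∧
          (∀ y ∈ K, expectedObjective f D (x + s • (x0 - x)) +
            inner ℝ G (y - (x + s • (x0 - x))) - L₁ * (s * ρ) ^ 2 ≤ expectedObjective f D y) ∧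
          ∀ τ : ℝ, 0 ≤ τ → ∀ v : Fin (384 * d) → ℝ,
            (∀ i, |v i - ∫ w, (φ i).toFun w ∂D| ≤ τ) →
            ‖∑ i, v i • b i - G‖ ≤ 384 * L₀ * τ := by
    intro x
    by_cases hx : x ∈ K
    · obtain ⟨φ, b, h⟩ := exists_gradient_queries hKcomp hL₀ hmeas hf (hshiftK x hx)
        (by positivity : 0 < L₁ * (s * ρ) ^ 2)
      exact ⟨φ, b, fun _ => h⟩
    · exact ⟨fun _ => StatQuery.zero W, fun _ => 0, fun h => absurd h hx⟩
  choose φ b hφ using hquery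
  obtain ⟨A, hA⟩ := exists_solver hKc hKcomp hne hκ hsmall hε φ
    fun x v => ∑ i, v i • b x i
  refine ⟨A, fun D _ hint hF hG => ?_⟩
  obtain ⟨g, hg, hlip⟩ := hG
  have hlow := hgrad hF hg
  have hconv : ∀ x ∈ K, ∀ y ∈ K, expectedObjective f D x + inner ℝ (g x) (y - x) ≤
      expectedObjective f D y := fun x hx y hy =>
    inner_gradient_le_sub (strongConvexOn_convexOn hκ.le hF) hx hy (hg x hx)
  refine (hA D _ _ (strongConvexOn_convexOn hκ.le hF) fun x hx => ?_).mono ?_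
  · obtain ⟨G, -, hG2, hG3⟩ := hφ x hx D hint
    refine ⟨g x, fun y hy => ?_, fun y hy => ?_, fun v hv => ?_⟩
    · linarith [hlow x hx y hy]
    -- Convexity at `y` bounds `F y - F x` by the inner product of `g y` with `y - x`; replacing `g
    -- y` by `g x` costs `L₁ * ‖y - x‖ ^ 2`, hence `L = 2 * L₁`.
    · have h1 := hconv y hy x hx
      have h2 := real_inner_le_norm (g y - g x) (y - x)
      have h3 := mul_le_mul_of_nonneg_right (hlip y hy x hx) (norm_nonneg (y - x))
      rw [← neg_sub y x, inner_neg_right] at h1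
      rw [inner_sub_left] at h2
      nlinarith
    · have h1 := hG3 _ (by positivity) v hv
      rw [oracle_tolerance hL₀] at h1
      have h2 := norm_sub_gradient_le hr0 hconv hlip (hshift x hx) hG2
      have h3 := hlip _ (hshiftK x hx) x hx
      rw [add_sub_cancel_left, norm_smul, Real.norm_of_nonneg hs0.le] at h3
      have h4 : L₁ * (s * ‖x0 - x‖) ≤ L₁ * (s * (2 * radius K)) := by
        have := dist_le_two_radius hKcomp hx0K hx
        gcongr
      have h5 : ∑ i, v i • b x i - g x = (∑ i, v i • b x i - G) +
          ((G - g (x + s • (x0 - x))) + (g (x + s • (x0 - x)) - g x)) := by abel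
      have h6 := norm_add_le (∑ i, v i • b x i - G)
        ((G - g (x + s • (x0 - x))) + (g (x + s • (x0 - x)) - g x))
      have h7 := norm_add_le (G - g (x + s • (x0 - x))) (g (x + s • (x0 - x)) - g x)
      rw [h5]
      linarith
  · have hb : 0 ≤ L₁ * radius K ^ 2 / ε := by positivity
    have e1 : 8 * (2 * L₁) * radius K ^ 2 / ε = 16 * (L₁ * radius K ^ 2 / ε) := by ring
    have h1 := max_one_log_mul_le (by norm_num) hb (by norm_num) log_sixteen_le
    rw [e1]
    push_cast
    calc 384 * (d : ℝ) * (16 * (2 * L₁) / κ *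
          max 1 (Real.log (16 * (L₁ * radius K ^ 2 / ε))))
        ≤ 384 * (d : ℝ) * (16 * (2 * L₁) / κ *
          ((1 + 3) * max 1 (Real.log (L₁ * radius K ^ 2 / ε)))) := by gcongr
      _ = 49152 * (d * (L₁ / κ) * max 1 (Real.log (L₁ * radius K ^ 2 / ε))) := by ring
      _ ≤ _ := by gcongr; norm_num

theorem mainTheorem8 :
    ∃ C c : ℝ, 0 < C ∧ 0 < c ∧
      ∀ (d : ℕ) (K : Set (EuclideanSpace ℝ (Fin d))) (_hK : IsConvexBody K)
        (W : Type u) [MeasurableSpace W] (f : EuclideanSpace ℝ (Fin d) → W → ℝ)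
        (L₀ κ ε : ℝ) (_hL₀ : 0 < L₀) (_hκ : 0 < κ) (_hε : 0 < ε)
        (_hmeas : ∀ x ∈ K, Measurable (f x))
        (_hf : ∀ w : W, IsConvexLipschitz K L₀ (fun x => f x w)),
        -- smooth case
        (∀ L₁ : ℝ, 0 < L₁ →
          ∃ A : SQAlgorithm W (EuclideanSpace ℝ (Fin d)),
            ∀ (D : Measure W) [IsProbabilityMeasure D],
              (∀ x ∈ K, Integrable (f x) D) →
              StrongConvexOn K κ (expectedObjective f D) →
              HasLipschitzGradient K L₁ (expectedObjective f D) →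
              A.Solves D (c * (Real.sqrt (ε * κ) / L₀))
                (C * (d * (L₁ / κ) * max 1 (Real.log (L₁ * radius K ^ 2 / ε))))
                (IsEpsOptimal K (expectedObjective f D) ε)) ∧
        -- no smoothness assumption
        (∃ A : SQAlgorithm W (EuclideanSpace ℝ (Fin d)),
            ∀ (D : Measure W) [IsProbabilityMeasure D],
              (∀ x ∈ K, Integrable (f x) D) →
              StrongConvexOn K κ (expectedObjective f D) →
              A.Solves D (c * (Real.sqrt (ε * κ) / L₀))
                (C * (d * (L₀ ^ 2 / (ε * κ)) * max 1 (Real.log (L₀ * radius K / ε))))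
                (IsEpsOptimal K (expectedObjective f D) ε)) := by
  refine ⟨1200000, 1 / 3072, by norm_num, by norm_num, ?_⟩
  intro d K hK W _ f L₀ κ ε hL₀ hκ hε hmeas hf
  exact ⟨fun L₁ hL₁ => exists_algorithm_smooth hK hL₀ hL₁ hκ hε hmeas hf,
    exists_algorithm_nonsmooth hK hL₀ hκ hε hmeas hf⟩
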